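/- Let $M$ be a compact connected smooth ($C^\infty$, Hausdorff, boundaryless) manifold with a smooth foliation $\mathcal F$ of codimension $q$, and let $k$ be any smooth Riemannian metric on $M$. A \emph{transverse similarity structure} on $(M,\mathcal F)$ is an open covering $\{U_i\}$ of $M$ with, for each $i$, a smooth transverse Riemannian metric $g_i$ on $(U_i,\mathcal F|_{U_i})$ (a bundle metric on $TU_i/T\mathcal F$), such that any two $g_i,g_j$ differ by a locally constant positive factor on $U_i\cap U_j$. It is \emph{holonomy-invariant} if for every holonomy map $\gamma$ of $\mathcal F$ from a connected transversal $T\subset U_i$ to a connected transversal $T'\subset U_j$ there is a constant $\lambda\in\mathbb R$ with $\gamma^*(g_j|_{T'})=\lambda\, g_i|_{T}$. Let $\mathcal N=T\mathcal F^{\perp_k}\simeq TM/T\mathcal F$. For a path $c$ contained in a leaf, from $x$ to $y$, let $h_c:\mathcal N_x\to\mathcal N_y$ be the infinitesimal holonomy along $c$, i.e. the derivative at $x$ of the holonomy map (between transversals at $x$ and $y$) obtained by sliding along $c$. The (infinitesimal) bi-equicontinuity domain is $$\mathcal E=\Big\{x\in M \;\Big|\; \exists\,\delta>1,\ \forall u\in\mathcal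 N_x,\ \text{for every path } c \text{ from } x \text{ in its leaf},\ \tfrac1\delta\|u\|_k\le\|h_c(u)\|_k\le\delta\|u\|_k\Big\}.$$ If $\mathcal F$ admits a holonomy-invariant transverse similarity structure and $\mathcal E\neq\emptyset$, then $\mathcal E=M$. In other words, $\mathcal E$ is either empty or all of $M$. -/

import Mathlib

open Set Filter Topology Bundle
open scoped Manifold ContDiff unitInterval

/-- The model Euclidean space `ℝ^d`. -/
abbrev Euc (d : ℕ) : Type := EuclideanSpace ℝ (Fin d)

/-- A smooth foliation with leaves of dimension `p` and of codimension `q` on a manifold `M`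
without boundary of dimension `p + q`, given by a covering by smooth charts with values in
`ℝ^p × ℝ^q` whose changes of coordinates are locally of the form
`(x, y) ↦ (f (x, y), h y)`. The plaques are the level sets of the `ℝ^q`-component. -/
structure Foliation (p q : ℕ) (M : Type*) [TopologicalSpace M] [ChartedSpace (Euc (p + q)) M] where
  charts : Set (OpenPartialHomeomorph M (Euc p × Euc q))
  covers : ∀ x : M, ∃ φ ∈ charts, x ∈ φ.source
  contMDiffOn : ∀ φ ∈ charts,
    ContMDiffOn (𝓡 (p + q)) 𝓘(ℝ, Euc p × Euc q) ∞ φ φ.source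
  contMDiffOn_symm : ∀ φ ∈ charts,
    ContMDiffOn 𝓘(ℝ, Euc p × Euc q) (𝓡 (p + q)) ∞ φ.symm φ.target
  compatible : ∀ φ ∈ charts, ∀ ψ ∈ charts, ∀ z ∈ (φ.symm.trans ψ).source, ∃ O ∈ 𝓝 z,
    ∀ w ∈ O, ∀ w' ∈ O, w.2 = w'.2 → (ψ (φ.symm w)).2 = (ψ (φ.symm w')).2

namespace Foliation

variable {p q : ℕ} {M : Type*} [TopologicalSpace M] [ChartedSpace (Euc (p + q)) M]

/-- The tangent space at `x` of the leaf through `x`. -/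
noncomputable def leafTangent (ℱ : Foliation p q M) (x : M) : Submodule ℝ (TangentSpace (𝓡 (p + q)) x) :=
  ⨅ φ ∈ ℱ.charts, ⨅ _ : x ∈ φ.source,
    LinearMap.ker (mfderiv (𝓡 (p + q)) 𝓘(ℝ, Euc q) (fun y : M => (φ y).2) x).toLinearMap

/-- A path contained in a leaf: a continuous map `[0,1] → M` which stays, locally in time, in one
plaque of each foliated chart. -/
def IsLeafPath (ℱ : Foliation p q M) (c : I → M) : Prop :=
  Continuous c ∧ ∀ φ ∈ ℱ.charts, ∀ t : I, c t ∈ φ.source →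
    ∀ᶠ s in 𝓝 t, (φ (c s)).2 = (φ (c t)).2

/-- A (parametrized) transversal: a `q`-dimensional injectively immersed submanifold which is
everywhere transverse to the leaves, parametrized by an open subset of `ℝ^q`. (As the leaves have
codimension `q`, transversality forces the parametrization to be an immersion.) -/
structure Transversal (ℱ : Foliation p q M) where
  dom : Set (Euc q)
  isOpen_dom : IsOpen dom
  map : Euc q → M
  contMDiffOn : ContMDiffOn (𝓡 q) (𝓡 (p + q)) ∞ map dom
  injOn : InjOn map dom
  transverse : ∀ v ∈ dom,
    LinearMap.range (mfderiv (𝓡 q) (𝓡 (p + q)) map v).toLinearMap ⊔ ℱ.leafTangent (map v) = ⊤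

/-- The derivative at the parameter `v` of the parametrization of a transversal. -/
noncomputable def Transversal.deriv {ℱ : Foliation p q M} (T : ℱ.Transversal) (v : Euc q) :
    Euc q →L[ℝ] TangentSpace (𝓡 (p + q)) (T.map v) :=
  mfderiv (𝓡 q) (𝓡 (p + q)) T.map v

/-- The same derivative, when the point of parameter `v` has been given a name `x`. -/
noncomputable def Transversal.derivAt {ℱ : Foliation p q M} (T : ℱ.Transversal) (v : Euc q) {x : M}
    (hx : T.map v = x) : Euc q →L[ℝ] TangentSpace (𝓡 (p + q)) x :=
  hx ▸ T.deriv v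

/-- `γ`, read in the parametrizations of `T` and `T'`, is a holonomy map from `T` to `T'`: a
diffeomorphism onto its image obtained by sliding every point `v` of `T` along a path `H v` in its
leaf, the path depending continuously on the point. -/
structure IsHolonomyMap (ℱ : Foliation p q M) (T T' : ℱ.Transversal) (γ : Euc q → Euc q)
    (H : Euc q → I → M) : Prop where
  mapsTo : MapsTo γ T.dom T'.dom
  contDiffOn : ContDiffOn ℝ ∞ γ T.dom
  injOn : InjOn γ T.dom
  continuousOn : ContinuousOn (fun z : Euc q × I => H z.1 z.2) (T.dom ×ˢ univ)
  leafPath : ∀ v ∈ T.dom, ℱ.IsLeafPath (H v)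
  source : ∀ v ∈ T.dom, H v 0 = T.map v
  target : ∀ v ∈ T.dom, H v 1 = T'.map (γ v)

/-- A transverse Riemannian metric of the foliation over the open set `dom`: a smooth bundle metric
on the normal bundle `TM / Tℱ`, given as the degenerate metric on `TM` with kernel `Tℱ`. -/
structure LocalTransverseMetric (ℱ : Foliation p q M) [IsManifold (𝓡 (p + q)) ∞ M] where
  dom : Set M
  isOpen_dom : IsOpen dom
  form : ∀ x : M, TangentSpace (𝓡 (p + q)) x →L[ℝ] TangentSpace (𝓡 (p + q)) x →L[ℝ] ℝ
  contMDiffOn : ContMDiffOn (𝓡 (p + q))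
    ((𝓡 (p + q)).prod 𝓘(ℝ, Euc (p + q) →L[ℝ] Euc (p + q) →L[ℝ] ℝ)) ∞
    (fun x => TotalSpace.mk' (Euc (p + q) →L[ℝ] Euc (p + q) →L[ℝ] ℝ)
      (E := fun x : M => TangentSpace (𝓡 (p + q)) x →L[ℝ] TangentSpace (𝓡 (p + q)) x →L[ℝ] ℝ)
      x (form x)) dom
  symm : ∀ x ∈ dom, ∀ v w, form x v w = form x w v
  nonneg : ∀ x ∈ dom, ∀ v, 0 ≤ form x v v
  eq_zero_iff : ∀ x ∈ dom, ∀ v, form x v v = 0 ↔ v ∈ ℱ.leafTangent x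

/-- A transverse similarity structure: transverse Riemannian metrics over the members of an open
covering of `M`, any two of which differ by a locally constant positive factor where both are
defined. -/
structure TransverseSimilarityStructure (ℱ : Foliation p q M) [IsManifold (𝓡 (p + q)) ∞ M] where
  metrics : Set ℱ.LocalTransverseMetric
  covers : ∀ x : M, ∃ g ∈ metrics, x ∈ g.dom
  compatible : ∀ g ∈ metrics, ∀ g' ∈ metrics, ∀ x ∈ g.dom ∩ g'.dom,
    ∃ r : ℝ, 0 < r ∧ ∀ᶠ y in 𝓝 x, g'.form y = r • g.form y

/-- Holonomy invariance of a transverse similarity structure: every holonomy map from a connected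
transversal contained in the domain of a metric `g` of the structure to a connected transversal
contained in the domain of a metric `g'` of the structure is a homothety from `g` to `g'`. -/
def TransverseSimilarityStructure.IsHolonomyInvariant {ℱ : Foliation p q M}
    [IsManifold (𝓡 (p + q)) ∞ M] (S : ℱ.TransverseSimilarityStructure) : Prop :=
  ∀ g ∈ S.metrics, ∀ g' ∈ S.metrics, ∀ (T T' : ℱ.Transversal) (γ : Euc q → Euc q)
    (H : Euc q → I → M), IsConnected T.dom → IsConnected T'.dom →
    T.map '' T.dom ⊆ g.dom → T'.map '' T'.dom ⊆ g'.dom → ℱ.IsHolonomyMap T T' γ H →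
    ∃ r : ℝ, ∀ v ∈ T.dom, ∀ ξ η : Euc q,
      g'.form (T'.map (γ v)) (T'.deriv (γ v) (fderiv ℝ γ v ξ)) (T'.deriv (γ v) (fderiv ℝ γ v η)) =
        r * g.form (T.map v) (T.deriv v ξ) (T.deriv v η)

section Normal

variable [IsManifold (𝓡 (p + q)) ∞ M]

/-- The fibre at `x` of the normal bundle of the foliation, realized as the orthogonal complement
of the tangent space of the leaf for the Riemannian metric `k`. -/
noncomputable def normalSpace (ℱ : Foliation p q M)
    (k : ContMDiffRiemannianMetric (𝓡 (p + q)) ∞ (Euc (p + q))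
      (fun x : M => TangentSpace (𝓡 (p + q)) x)) (x : M) :
    Submodule ℝ (TangentSpace (𝓡 (p + q)) x) :=
  ⨅ w ∈ ℱ.leafTangent x, LinearMap.ker (k.inner x w).toLinearMap

/-- `h` is the infinitesimal holonomy along the leaf path `c`: the derivative at `x = c 0` of a
holonomy map from a transversal at `x` to a transversal at `y = c 1` which slides `x` along `c`,
seen as a map between the normal spaces (vectors tangent to transversals being taken modulo the
tangent spaces of the leaves). -/
def IsInfinitesimalHolonomy (ℱ : Foliation p q M)
    (k : ContMDiffRiemannianMetric (𝓡 (p + q)) ∞ (Euc (p + q))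
      (fun x : M => TangentSpace (𝓡 (p + q)) x)) {x y : M} (c : Path x y)
    (h : ℱ.normalSpace k x →ₗ[ℝ] ℱ.normalSpace k y) : Prop :=
  ∃ (T T' : ℱ.Transversal) (γ : Euc q → Euc q) (H : Euc q → I → M) (a : Euc q)
    (hx : T.map a = x) (hy : T'.map (γ a) = y),
    ℱ.IsHolonomyMap T T' γ H ∧ a ∈ T.dom ∧ (∀ t, H a t = c t) ∧
    ∀ (u : ℱ.normalSpace k x) (ξ : Euc q),
      T.derivAt a hx ξ - u ∈ ℱ.leafTangent x →
      T'.derivAt (γ a) hy (fderiv ℝ γ a ξ) - h u ∈ ℱ.leafTangent y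

/-- The bi-equicontinuity domain: the points `x` for which there is `δ > 1` such that the
infinitesimal holonomy along any path emanating from `x` in its leaf distorts norms by a factor
between `1 / δ` and `δ`. -/
def biEquicontinuityDomain (ℱ : Foliation p q M)
    (k : ContMDiffRiemannianMetric (𝓡 (p + q)) ∞ (Euc (p + q))
      (fun x : M => TangentSpace (𝓡 (p + q)) x)) : Set M :=
  {x | ∃ δ : ℝ, 1 < δ ∧ ∀ (y : M) (c : Path x y), ℱ.IsLeafPath c →
    ∀ h : ℱ.normalSpace k x →ₗ[ℝ] ℱ.normalSpace k y, ℱ.IsInfinitesimalHolonomy k c h →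
    ∀ u : ℱ.normalSpace k x,
      √(k.inner x u u) / δ ≤ √(k.inner y (h u) (h u)) ∧
      √(k.inner y (h u) (h u)) ≤ δ * √(k.inner x u u)}

end Normal

end Foliation

/-!
Write `D φ x` (`transDeriv`) for the derivative at `x` of the transverse component of a foliated
chart `φ`: its kernel is the tangent space of the leaf. A vector field along a leaf path is parallel
(`IsParallel`) if its images under these maps are locally constant in time; modulo the leaves, it is
determined by its initial value (`IsParallel.congr_end`). The variation of a family of leaf paths is
parallel (`exists_isParallel_of_family`), so that an infinitesimal holonomy is nothing but parallel
transport, and depends only on the path (`IsInfinitesimalHolonomy.exists_isParallel`).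

The compact manifold `M` is covered by finitely many boxes, in each of which the Riemannian metric
on the normal bundle and a metric of the similarity structure are comparable to the Euclidean norm
of the transverse coordinates (`nonempty_boxCover`). So the domain is the set of points at which the
parallel transports along all leaf paths have uniformly bounded distortion
(`BoxCover.biEquicontinuityDomain_eq`). A ball in a transversal can be slid along a leaf path `c` as
long as it remains of small size (`IsSlide.extend`). By holonomy invariance the slid ball is
dilated, up to a uniform constant, by the same factor at all of its points (`BoxCover.conformal`).
If the dilatation is bounded by `K` at one point of the ball, at all times, a ball of radius
`size / K` can thus be slid until the end of `c` (`BoxCover.exists_isSlide_of_bound`).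

* The domain is open. If the distortion is bounded at `x`, and `c` is a leaf path from a point `y`
  close to `x`, a ball around `y` which meets the plaque of `x` can be slid along `c`, whatever `c`,
  and the dilatation at `y` is that at `x`, up to a constant (`BoxCover.isOpen_boundedSet`).
* The domain is closed. Otherwise a point of its closure has leaf paths of arbitrarily strong
  distortion. Such a path, run from a point `m` where a parallel field is largest to an end where it
  is small, does not dilate by more than a constant and contracts strongly in the end (this reverses
  the path if it was dilating). Hence a ball around `m` *of uniform size* is strongly contracted
  (`BoxCover.exists_large_distortion`). The domain and its closure are saturated, so `m` is in the
  closure. The points `m` accumulate at a point of the closure, and a point of the domain close to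
  it would be arbitrarily strongly contracted (`BoxCover.isClosed_boundedSet`). It is here that the
  lower bound in the definition of the domain is used.

As `M` is connected, a nonempty domain is all of `M`.
-/

/-! ### Foliated charts, leaf paths and parallel fields of the Bott connection -/

namespace Foliation

section Charts

variable {p q : ℕ} {M : Type*} [TopologicalSpace M] [ChartedSpace (Euc (p + q)) M]

/-- The derivative at `x` of the transverse component of the map `φ`, as a linear map on the model
space `ℝ^(p+q)` of the tangent space of `M` at `x`. -/
noncomputable def transDeriv (φ : M → Euc p × Euc q) (x : M) : Euc (p + q) →L[ℝ] Euc q :=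
  mfderiv (𝓡 (p + q)) 𝓘(ℝ, Euc q) (fun y : M => (φ y).2) x

/-- The derivative of a map from a normed space to `M`, as a linear map to the model space of the
tangent spaces of `M`. -/
noncomputable def paramDeriv {E' : Type*} [NormedAddCommGroup E'] [NormedSpace ℝ E'] (f : E' → M)
    (v : E') : E' →L[ℝ] Euc (p + q) :=
  mfderiv 𝓘(ℝ, E') (𝓡 (p + q)) f v

variable {ℱ : Foliation p q M} {φ ψ : OpenPartialHomeomorph M (Euc p × Euc q)} {x y : M}

theorem mdifferentiableAt_symm (hφ : φ ∈ ℱ.charts) {z : Euc p × Euc q} (hz : z ∈ φ.target) :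
    MDifferentiableAt 𝓘(ℝ, Euc p × Euc q) (𝓡 (p + q)) φ.symm z :=
  ((ℱ.contMDiffOn_symm φ hφ).contMDiffAt (φ.open_target.mem_nhds hz)).mdifferentiableAt (by simp)

theorem mdifferentiableAt_chart (hφ : φ ∈ ℱ.charts) (hx : x ∈ φ.source) :
    MDifferentiableAt (𝓡 (p + q)) 𝓘(ℝ, Euc p × Euc q) φ x :=
  ((ℱ.contMDiffOn φ hφ).contMDiffAt (φ.open_source.mem_nhds hx)).mdifferentiableAt (by simp)

theorem mdifferentiableAt_trans (hφ : φ ∈ ℱ.charts) (hx : x ∈ φ.source) :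
    MDifferentiableAt (𝓡 (p + q)) 𝓘(ℝ, Euc q) (fun y : M => (φ y).2) x := by
  have h : MDifferentiableAt 𝓘(ℝ, Euc p × Euc q) 𝓘(ℝ, Euc q)
      (Prod.snd : Euc p × Euc q → Euc q) (φ x) := differentiableAt_snd.mdifferentiableAt
  exact h.comp x (mdifferentiableAt_chart hφ hx)

theorem transDeriv_comp {E' : Type*} [NormedAddCommGroup E'] [NormedSpace ℝ E'] {f : E' → M}
    {v : E'} (hφ : φ ∈ ℱ.charts) (hx : f v ∈ φ.source)
    (hf : MDifferentiableAt 𝓘(ℝ, E') (𝓡 (p + q)) f v) :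
    HasFDerivAt (fun v => (φ (f v)).2)
      ((transDeriv φ (f v)).comp (paramDeriv f v)) v := by
  have h := (mdifferentiableAt_trans hφ hx).hasMFDerivAt.comp v hf.hasMFDerivAt
  exact h.hasFDerivAt

theorem transDeriv_mfderiv {E' : Type*} [NormedAddCommGroup E'] [NormedSpace ℝ E'] {f : E' → M}
    {v : E'} (hφ : φ ∈ ℱ.charts) (hx : f v ∈ φ.source)
    (hf : MDifferentiableAt 𝓘(ℝ, E') (𝓡 (p + q)) f v) {L : E' →L[ℝ] Euc q}
    (hL : HasFDerivAt (fun v => (φ (f v)).2) L v) (e : E') :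
    transDeriv φ (f v) (paramDeriv f v e) = L e :=
  congrArg (fun L : E' →L[ℝ] Euc q => L e) ((transDeriv_comp hφ hx hf).unique hL)

/-- The derivative of the inverse of a foliated chart is a section of the transverse derivative. -/
theorem transDeriv_symm (hφ : φ ∈ ℱ.charts) {z : Euc p × Euc q} (hz : z ∈ φ.target)
    (e : Euc p × Euc q) :
    transDeriv φ (φ.symm z) (paramDeriv φ.symm z e) = e.2 := by
  have h2 : HasFDerivAt (fun v => (φ (φ.symm v)).2) (ContinuousLinearMap.snd ℝ (Euc p) (Euc q)) z :=
    hasFDerivAt_snd.congr_of_eventuallyEq <| by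
      filter_upwards [φ.open_target.mem_nhds hz] with w hw
      rw [φ.right_inv hw]
  exact transDeriv_mfderiv hφ (φ.map_target hz) (mdifferentiableAt_symm hφ hz) h2 e

theorem transDeriv_surjective (hφ : φ ∈ ℱ.charts) (hx : x ∈ φ.source) :
    Function.Surjective (transDeriv φ x) := fun ξ =>
  ⟨_, by simpa [φ.left_inv hx] using transDeriv_symm hφ (φ.map_source hx) (0, ξ)⟩

/-- Near a common point, the transverse coordinates of one foliated chart are a differentiable
function of those of another one. -/
theorem exists_transition (hφ : φ ∈ ℱ.charts) (hψ : ψ ∈ ℱ.charts) (hx : x ∈ φ.source)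
    (hx' : x ∈ ψ.source) :
    ∃ τ : Euc q → Euc q, DifferentiableAt ℝ τ (φ x).2 ∧
      ∀ᶠ y in 𝓝 x, (ψ y).2 = τ (φ y).2 := by
  obtain ⟨O, hO, h⟩ := ℱ.compatible φ hφ ψ hψ (φ x) (by
    simp [φ.left_inv hx, hx', φ.map_source hx])
  refine ⟨fun v => (ψ (φ.symm ((φ x).1, v))).2, ?_, ?_⟩
  · have h1 : DifferentiableAt ℝ (fun v : Euc q => ((φ x).1, v)) (φ x).2 :=
      (differentiableAt_const _).prodMk differentiableAt_id
    have h2 := transDeriv_comp (f := φ.symm) (v := φ x) hψ (by rwa [φ.left_inv hx])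
      (mdifferentiableAt_symm hφ (φ.map_source hx))
    exact DifferentiableAt.comp (g := fun z => (ψ (φ.symm z)).2) (φ x).2 h2.differentiableAt h1
  · have c1 : ContinuousAt φ x := φ.continuousAt hx
    have c2 : ContinuousAt (fun y => ((φ x).1, (φ y).2)) x := continuousAt_const.prodMk c1.snd
    filter_upwards [c1 hO, c2 hO, φ.open_source.mem_nhds hx] with y h1 h2 h3
    rw [← h _ h1 _ h2 rfl, φ.left_inv h3]

theorem exists_transDeriv_eq_comp (hφ : φ ∈ ℱ.charts) (hψ : ψ ∈ ℱ.charts) (hx : x ∈ φ.source)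
    (hx' : x ∈ ψ.source) :
    ∃ A : Euc q →L[ℝ] Euc q, transDeriv ψ x = A.comp (transDeriv φ x) := by
  obtain ⟨τ, hτ, h⟩ := exists_transition hφ hψ hx hx'
  refine ⟨fderiv ℝ τ (φ x).2, ?_⟩
  have h1 : HasMFDerivAt (𝓡 (p + q)) 𝓘(ℝ, Euc q) (fun y : M => τ (φ y).2) x
      ((fderiv ℝ τ (φ x).2).comp (transDeriv φ x)) :=
    HasMFDerivAt.comp (g := τ) x hτ.hasFDerivAt.hasMFDerivAt
      (mdifferentiableAt_trans hφ hx).hasMFDerivAt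
  exact (h1.congr_of_eventuallyEq h).mfderiv

theorem transDeriv_eq_zero_of (hφ : φ ∈ ℱ.charts) (hψ : ψ ∈ ℱ.charts) (hx : x ∈ φ.source)
    (hx' : x ∈ ψ.source) {w : Euc (p + q)} (hw : transDeriv φ x w = 0) :
    transDeriv ψ x w = 0 := by
  obtain ⟨A, hA⟩ := exists_transDeriv_eq_comp hφ hψ hx hx'
  simp [hA, hw]

theorem mem_leafTangent_iff (hφ : φ ∈ ℱ.charts) (hx : x ∈ φ.source)
    (w : TangentSpace (𝓡 (p + q)) x) :
    w ∈ ℱ.leafTangent x ↔ transDeriv φ x w = 0 := by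
  simp only [leafTangent, Submodule.mem_iInf]
  exact ⟨fun h => h φ hφ hx, fun h ψ hψ hx' => transDeriv_eq_zero_of hφ hψ hx hx' h⟩

theorem sub_mem_leafTangent_iff (hφ : φ ∈ ℱ.charts) (hx : x ∈ φ.source)
    (w w' : TangentSpace (𝓡 (p + q)) x) :
    w - w' ∈ ℱ.leafTangent x ↔ transDeriv φ x w = transDeriv φ x w' := by
  rw [mem_leafTangent_iff hφ hx, ← sub_eq_zero (a := transDeriv φ x w)]
  exact Eq.congr_left ((transDeriv φ x).map_sub w w')

end Charts

section Gluing

/-- A map `f` on `[0,1]` such that, for all `i`, the function `val i ∘ f` is locally constant where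
`f` is in the domain `src i` of `val i`. Leaf paths, and the sections of the normal bundle which are
parallel along them, are of this kind. -/
def LocallyPlaque {X ι Y : Type*} (src : ι → Set X) (val : ι → X → Y) (f : I → X) : Prop :=
  ∀ i t, f t ∈ src i → ∀ᶠ s in 𝓝 t, val i (f s) = val i (f t)

variable {X ι Y : Type*} {src : ι → Set X} {val : ι → X → Y} {f g : I → X}

theorem LocallyPlaque.comp (hf : LocallyPlaque src val f) {θ : I → I} (hθ : Continuous θ) :
    LocallyPlaque src val (f ∘ θ) := fun i t h =>
  hθ.continuousAt.eventually (hf i (θ t) h)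

theorem LocallyPlaque.glue (hf : LocallyPlaque src val f) (hg : LocallyPlaque src val g) (t₀ : I)
    (h : f t₀ = g t₀) : LocallyPlaque src val (fun s => if s ≤ t₀ then f s else g s) := by
  intro i t ht
  rcases lt_trichotomy t t₀ with hlt | rfl | hlt
  · simp only [if_pos hlt.le] at ht ⊢
    filter_upwards [hf i t ht, eventually_lt_nhds hlt] with s hs hs'
    rwa [if_pos hs'.le]
  · simp only [if_pos le_rfl] at ht ⊢
    filter_upwards [hf i t ht, hg i t (h ▸ ht)] with s hs hs'
    split_ifs
    · exact hs
    · rw [hs', h]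
  · simp only [if_neg hlt.not_ge] at ht ⊢
    filter_upwards [hg i t ht, eventually_gt_nhds hlt] with s hs hs'
    rwa [if_neg hs'.not_ge]

end Gluing

section Paths

variable {p q : ℕ} {M : Type*} [TopologicalSpace M] [ChartedSpace (Euc (p + q)) M]
  {ℱ : Foliation p q M} {φ ψ : OpenPartialHomeomorph M (Euc p × Euc q)} {c d : I → M}

theorem isPreconnected_ball_unitInterval (t : I) (r : ℝ) : IsPreconnected (Metric.ball t r) := by
  have : (Metric.ball t r).OrdConnected := ⟨by
    intro x hx y hy z hz
    simp only [Metric.mem_ball, Subtype.dist_eq, Real.dist_eq, abs_lt] at *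
    have h1 : (x : ℝ) ≤ z := hz.1
    have h2 : (z : ℝ) ≤ y := hz.2
    constructor <;> linarith [hx.1, hy.2]⟩
  exact this.isPreconnected

theorem isLeafPath_iff : ℱ.IsLeafPath c ↔ Continuous c ∧
    LocallyPlaque (fun φ : ℱ.charts => φ.1.source) (fun φ x => (φ.1 x).2) c := by
  simp [IsLeafPath, LocallyPlaque]

theorem IsLeafPath.comp (hc : ℱ.IsLeafPath c) {θ : I → I} (hθ : Continuous θ) :
    ℱ.IsLeafPath (c ∘ θ) := by
  rw [isLeafPath_iff] at *
  exact ⟨hc.1.comp hθ, hc.2.comp hθ⟩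

theorem IsLeafPath.glue (hc : ℱ.IsLeafPath c) (hd : ℱ.IsLeafPath d) (t₀ : I) (h : c t₀ = d t₀) :
    ℱ.IsLeafPath (fun s => if s ≤ t₀ then c s else d s) := by
  rw [isLeafPath_iff] at *
  exact ⟨Continuous.if_le hc.1 hd.1 continuous_id continuous_const (fun s hs => hs ▸ h),
    hc.2.glue hd.2 t₀ h⟩

/-- A path which stays in a plaque of a foliated chart is a leaf path. -/
theorem isLeafPath_of_plaque (hφ : φ ∈ ℱ.charts) (hc : Continuous c) (hs : ∀ t, c t ∈ φ.source)
    (h : ∀ s t, (φ (c s)).2 = (φ (c t)).2) : ℱ.IsLeafPath c := by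
  refine ⟨hc, fun ψ hψ t ht => ?_⟩
  obtain ⟨τ, -, hτ⟩ := exists_transition hφ hψ (hs t) ht
  filter_upwards [hc.continuousAt.eventually hτ] with s hs'
  rw [hs', hτ.self_of_nhds, h s t]

/-- As long as a leaf path stays in a foliated chart, its transverse coordinates are constant. -/
theorem IsLeafPath.eq_of_subset (hc : ℱ.IsLeafPath c) (hφ : φ ∈ ℱ.charts) {J : Set I}
    (hJ : IsPreconnected J) (hs : ∀ t ∈ J, c t ∈ φ.source) {s t : I} (h : s ∈ J) (h' : t ∈ J) :
    (φ (c s)).2 = (φ (c t)).2 :=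
  hJ.induction₂ (fun s t => (φ (c s)).2 = (φ (c t)).2)
    (fun t ht => nhdsWithin_le_nhds ((hc.2 φ hφ t (hs t ht)).mono fun _ h => h.symm))
    (fun _ _ _ _ _ _ h1 h2 => h1.trans h2) (fun _ _ _ _ h => h.symm) h h'

/-- The vector field `w` along the leaf path `c` is parallel, modulo the tangent spaces of the
leaves, for the Bott connection: its transverse components in the foliated charts are locally
constant in time. -/
def IsParallel (ℱ : Foliation p q M) (c : I → M) (w : I → Euc (p + q)) : Prop :=
  ∀ φ ∈ ℱ.charts, ∀ t, c t ∈ φ.source →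
    ∀ᶠ s in 𝓝 t, transDeriv φ (c s) (w s) = transDeriv φ (c t) (w t)

variable {w w' : I → Euc (p + q)}

theorem isParallel_iff : ℱ.IsParallel c w ↔
    LocallyPlaque (fun φ : ℱ.charts => {z : M × Euc (p + q) | z.1 ∈ φ.1.source})
      (fun φ z => transDeriv φ.1 z.1 z.2) (fun t => (c t, w t)) := by
  simp [IsParallel, LocallyPlaque]

theorem IsParallel.comp (hw : ℱ.IsParallel c w) {θ : I → I} (hθ : Continuous θ) :
    ℱ.IsParallel (c ∘ θ) (w ∘ θ) := by
  rw [isParallel_iff] at *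
  exact hw.comp hθ

theorem IsParallel.glue (hw : ℱ.IsParallel c w) (hw' : ℱ.IsParallel d w') (t₀ : I)
    (h : c t₀ = d t₀) (h' : w t₀ = w' t₀) :
    ℱ.IsParallel (fun s => if s ≤ t₀ then c s else d s)
      (fun s => if s ≤ t₀ then w s else w' s) := by
  rw [isParallel_iff] at *
  convert hw.glue hw' t₀ (by simp [h, h']) using 2 with s
  split_ifs <;> rfl

theorem IsParallel.sub (hw : ℱ.IsParallel c w) (hw' : ℱ.IsParallel c w') :
    ℱ.IsParallel c (fun t => w t - w' t) := fun φ hφ t ht => by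
  filter_upwards [hw φ hφ t ht, hw' φ hφ t ht] with s h h'
  rw [map_sub, map_sub, h, h']

theorem IsParallel.eq_of_subset (hw : ℱ.IsParallel c w) (hφ : φ ∈ ℱ.charts) {J : Set I}
    (hJ : IsPreconnected J) (hs : ∀ t ∈ J, c t ∈ φ.source) {s t : I} (h : s ∈ J) (h' : t ∈ J) :
    transDeriv φ (c s) (w s) = transDeriv φ (c t) (w t) :=
  hJ.induction₂ (fun s t => transDeriv φ (c s) (w s) = transDeriv φ (c t) (w t))
    (fun t ht => nhdsWithin_le_nhds ((hw φ hφ t (hs t ht)).mono fun _ h => h.symm))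
    (fun _ _ _ _ _ _ h1 h2 => h1.trans h2) (fun _ _ _ _ h => h.symm) h h'

/-- A parallel field which is tangent to the leaf at some time is always so. -/
theorem IsParallel.eq_zero (hc : Continuous c) (hw : ℱ.IsParallel c w) {s t : I}
    (hφ : φ ∈ ℱ.charts) (hs : c s ∈ φ.source) (hψ : ψ ∈ ℱ.charts) (ht : c t ∈ ψ.source)
    (h : transDeriv φ (c s) (w s) = 0) : transDeriv ψ (c t) (w t) = 0 := by
  let P : I → Prop := fun t => ∀ φ ∈ ℱ.charts, c t ∈ φ.source → transDeriv φ (c t) (w t) = 0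
  have key : P s → P t := by
    refine isPreconnected_univ.induction₂ (fun s t => (P s ↔ P t)) (fun t _ => ?_)
      (fun _ _ _ _ _ _ h1 h2 => h1.trans h2) (fun _ _ _ _ h => h.symm) (mem_univ s) (mem_univ t)
      |>.1
    rw [nhdsWithin_univ]
    obtain ⟨χ, hχ, htχ⟩ := ℱ.covers (c t)
    filter_upwards [hw χ hχ t htχ, hc.continuousAt.eventually (χ.open_source.mem_nhds htχ)]
      with r hr hr'
    constructor
    · intro hP φ hφ hφr
      exact transDeriv_eq_zero_of hχ hφ hr' hφr (hr.trans (hP χ hχ htχ))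
    · intro hP φ hφ hφt
      exact transDeriv_eq_zero_of hχ hφ htχ hφt (hr.symm.trans (hP χ hχ hr'))
  exact key (fun χ hχ hsχ => transDeriv_eq_zero_of hφ hχ hs hsχ h) ψ hψ ht

/-- A parallel field is determined, modulo the leaves, by its value at one time. -/
theorem IsParallel.congr_end (hc : Continuous c) (hw : ℱ.IsParallel c w) (hw' : ℱ.IsParallel c w')
    {s t : I} (hφ : φ ∈ ℱ.charts) (hs : c s ∈ φ.source) (hψ : ψ ∈ ℱ.charts) (ht : c t ∈ ψ.source)
    (h : transDeriv φ (c s) (w s) = transDeriv φ (c s) (w' s)) :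
    transDeriv ψ (c t) (w t) = transDeriv ψ (c t) (w' t) := by
  have := (hw.sub hw').eq_zero hc hφ hs hψ ht (by rw [map_sub, h, sub_self])
  rwa [map_sub, sub_eq_zero] at this

/-- The variation of a continuous family of leaf paths, differentiable transversally at time `0`,
is a parallel field along the central path. Only the continuity of the family is assumed at the
other times: there its transverse differentiability follows from that at time `0`, the transverse
coordinates of all the paths being locally constant in time. -/
theorem exists_isParallel_of_family {E' : Type*} [NormedAddCommGroup E'] [NormedSpace ℝ E']
    {H : E' → I → M} {D : Set E'} {a : E'} (hD : D ∈ 𝓝 a)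
    (hH : ContinuousOn (fun z : E' × I => H z.1 z.2) (D ×ˢ univ))
    (hleaf : ∀ v ∈ D, ℱ.IsLeafPath (H v)) (hφ : φ ∈ ℱ.charts) (h0 : H a 0 ∈ φ.source)
    (hd : DifferentiableAt ℝ (fun v => (φ (H v 0)).2) a) (ξ : E') :
    ∃ w : I → Euc (p + q), ℱ.IsParallel (H a) w ∧ ∀ t, ∀ ψ ∈ ℱ.charts, H a t ∈ ψ.source →
      transDeriv ψ (H a t) (w t) = fderiv ℝ (fun v => (ψ (H v t)).2) a ξ := by
  have haD : a ∈ D := mem_of_mem_nhds hD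
  have hHat : ∀ t, ContinuousAt (fun z : E' × I => H z.1 z.2) (a, t) := fun t =>
    hH.continuousAt (prod_mem_nhds hD univ_mem)
  have hHv : ∀ t, ContinuousAt (fun v => H v t) a := fun t =>
    (hHat t).comp (f := fun v => (v, t)) (continuousAt_id.prodMk continuousAt_const)
  -- in a chart around `H a t`, the transverse coordinate is the same function of `v` at all times
  -- close to `t`
  have hloc : ∀ t, ∀ χ ∈ ℱ.charts, H a t ∈ χ.source → ∀ᶠ s in 𝓝 t, H a s ∈ χ.source ∧
      (fun v => (χ (H v s)).2) =ᶠ[𝓝 a] fun v => (χ (H v t)).2 := by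
    intro t χ hχ ht
    have h1 := (hHat t).eventually (χ.open_source.mem_nhds ht)
    rw [nhds_prod_eq] at h1
    obtain ⟨U, hU, V, hV, hUV⟩ := eventually_prod_iff.1 h1
    obtain ⟨r, hr, hWV⟩ := Metric.mem_nhds_iff.1 hV
    have htW : t ∈ Metric.ball t r := Metric.mem_ball_self hr
    filter_upwards [Metric.ball_mem_nhds t hr] with s hs
    refine ⟨hUV hU.self_of_nhds (hWV hs), ?_⟩
    filter_upwards [hU, hD] with v hv hvD
    exact (hleaf v hvD).eq_of_subset hχ (isPreconnected_ball_unitInterval t r)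
      (fun r hr => hUV hv (hWV hr)) hs htW
  have htrans : ∀ t, ∀ χ ∈ ℱ.charts, H a t ∈ χ.source →
      DifferentiableAt ℝ (fun v => (χ (H v t)).2) a → ∀ ψ ∈ ℱ.charts, H a t ∈ ψ.source →
      DifferentiableAt ℝ (fun v => (ψ (H v t)).2) a ∧
        ∀ u, transDeriv χ (H a t) u = fderiv ℝ (fun v => (χ (H v t)).2) a ξ →
          transDeriv ψ (H a t) u = fderiv ℝ (fun v => (ψ (H v t)).2) a ξ := by
    intro t χ hχ htχ hdχ ψ hψ htψ
    obtain ⟨τ, hτ, hev⟩ := exists_transition hχ hψ htχ htψ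
    have hd1 : HasFDerivAt (fun v => τ (χ (H v t)).2)
        ((fderiv ℝ τ (χ (H a t)).2).comp (fderiv ℝ (fun v => (χ (H v t)).2) a)) a :=
      HasFDerivAt.comp a hτ.hasFDerivAt hdχ.hasFDerivAt
    have hd2 := hd1.congr_of_eventuallyEq ((hHv t).eventually hev)
    refine ⟨hd2.differentiableAt, fun u hu => ?_⟩
    have h1 : HasMFDerivAt (𝓡 (p + q)) 𝓘(ℝ, Euc q) (fun y : M => τ (χ y).2) (H a t)
        ((fderiv ℝ τ (χ (H a t)).2).comp (transDeriv χ (H a t))) :=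
      HasMFDerivAt.comp (g := τ) (H a t) hτ.hasFDerivAt.hasMFDerivAt
        (mdifferentiableAt_trans hχ htχ).hasMFDerivAt
    have h2 : transDeriv ψ (H a t) = (fderiv ℝ τ (χ (H a t)).2).comp (transDeriv χ (H a t)) :=
      (h1.congr_of_eventuallyEq hev).mfderiv
    rw [h2, hd2.fderiv, ContinuousLinearMap.comp_apply, hu, ContinuousLinearMap.comp_apply]
  let P : I → Prop := fun t => ∀ χ ∈ ℱ.charts, H a t ∈ χ.source →
    DifferentiableAt ℝ (fun v => (χ (H v t)).2) a
  have hP : ∀ t, P t := by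
    intro t
    refine (isPreconnected_univ.induction₂ (fun s t => (P s ↔ P t)) (fun t _ => ?_)
      (fun _ _ _ _ _ _ h1 h2 => h1.trans h2) (fun _ _ _ _ h => h.symm) (mem_univ 0) (mem_univ t)).1
      (fun χ hχ h => (htrans 0 φ hφ h0 hd χ hχ h).1)
    rw [nhdsWithin_univ]
    obtain ⟨χ, hχ, htχ⟩ := ℱ.covers (H a t)
    filter_upwards [hloc t χ hχ htχ] with s ⟨hsχ, hs⟩
    exact ⟨fun h ψ hψ hsψ => (htrans s χ hχ hsχ
        ((h χ hχ htχ).congr_of_eventuallyEq hs) ψ hψ hsψ).1,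
      fun h ψ hψ hsψ => (htrans t χ hχ htχ
        ((h χ hχ hsχ).congr_of_eventuallyEq hs.symm) ψ hψ hsψ).1⟩
  choose χ hχ htχ using fun t => ℱ.covers (H a t)
  choose w hw using fun t => transDeriv_surjective (hχ t) (htχ t)
    (fderiv ℝ (fun v => (χ t (H v t)).2) a ξ)
  have hw' : ∀ t, ∀ ψ ∈ ℱ.charts, H a t ∈ ψ.source →
      transDeriv ψ (H a t) (w t) = fderiv ℝ (fun v => (ψ (H v t)).2) a ξ := fun t ψ hψ ht =>
    (htrans t (χ t) (hχ t) (htχ t) (hP t _ (hχ t) (htχ t)) ψ hψ ht).2 _ (hw t)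
  refine ⟨w, fun ψ hψ t ht => ?_, hw'⟩
  filter_upwards [hloc t ψ hψ ht] with s ⟨hsψ, hs⟩
  rw [hw' s ψ hψ hsψ, hw' t ψ hψ ht, hs.fderiv_eq]

end Paths

end Foliation

/-! ### Vertical transversals, normal spaces and infinitesimal holonomy -/

namespace Foliation

section Vertical

variable {p q : ℕ} {M : Type*} [TopologicalSpace M] [ChartedSpace (Euc (p + q)) M]
  {ℱ : Foliation p q M} {φ ψ : OpenPartialHomeomorph M (Euc p × Euc q)} {x y : M}

theorem contMDiffOn_vertical (hφ : φ ∈ ℱ.charts) (x₀ : Euc p) {D : Set (Euc q)}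
    (h : ∀ v ∈ D, (x₀, v) ∈ φ.target) :
    ContMDiffOn (𝓡 q) (𝓡 (p + q)) ∞ (fun v => φ.symm (x₀, v)) D := by
  have h1 : ContMDiff (𝓡 q) 𝓘(ℝ, Euc p × Euc q) ∞ (fun v : Euc q => (x₀, v)) :=
    ((contDiff_const.prodMk contDiff_id : ContDiff ℝ ∞ (fun v : Euc q => (x₀, v)))).contMDiff
  exact (ℱ.contMDiffOn_symm φ hφ).comp h1.contMDiffOn h

theorem transDeriv_vertical (hφ : φ ∈ ℱ.charts) {x₀ : Euc p} {v : Euc q}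
    (h : (x₀, v) ∈ φ.target) (ξ : Euc q) :
    transDeriv φ (φ.symm (x₀, v)) (paramDeriv (fun v => φ.symm (x₀, v)) v ξ) = ξ := by
  have hc : Continuous fun v : Euc q => (x₀, v) := by fun_prop
  have hmem : ∀ᶠ v' in 𝓝 v, (x₀, v') ∈ φ.target :=
    hc.continuousAt.eventually (φ.open_target.mem_nhds h)
  have hd : MDifferentiableAt (𝓡 q) (𝓡 (p + q)) (fun v => φ.symm (x₀, v)) v :=
    ((contMDiffOn_vertical hφ x₀ (fun _ h => h)).contMDiffAt hmem).mdifferentiableAt (by simp)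
  refine transDeriv_mfderiv (f := fun v => φ.symm (x₀, v))
    (L := ContinuousLinearMap.id ℝ (Euc q)) hφ (φ.map_target h) hd ?_ ξ
  refine (hasFDerivAt_id v).congr_of_eventuallyEq ?_
  filter_upwards [hmem] with v' hv'
  simp [φ.right_inv hv']

/-- The transversal `{x₀} × D` of a foliated chart. -/
noncomputable def vertical (hφ : φ ∈ ℱ.charts) (x₀ : Euc p) (D : Set (Euc q)) (hD : IsOpen D)
    (h : ∀ v ∈ D, (x₀, v) ∈ φ.target) : ℱ.Transversal where
  dom := D
  isOpen_dom := hD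
  map v := φ.symm (x₀, v)
  contMDiffOn := contMDiffOn_vertical hφ x₀ h
  injOn v hv v' hv' hvv' := by
    simpa using φ.symm.injOn (h v hv) (h v' hv') hvv'
  transverse v hv := by
    rw [eq_top_iff]
    intro w _
    have hv' := transDeriv_vertical hφ (h v hv) (transDeriv φ (φ.symm (x₀, v)) w)
    refine Submodule.mem_sup.2 ⟨_, LinearMap.mem_range_self _
      (transDeriv φ (φ.symm (x₀, v)) w), w - _, ?_, add_sub_cancel _ w⟩
    rw [sub_mem_leafTangent_iff hφ (φ.map_target (h v hv))]
    exact hv'.symm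

/-- The chain rule along the parametrization of a transversal. -/
theorem transDeriv_deriv {T : ℱ.Transversal} {v : Euc q} (hv : v ∈ T.dom) (hφ : φ ∈ ℱ.charts)
    (h : T.map v ∈ φ.source) :
    HasFDerivAt (fun v => (φ (T.map v)).2)
      ((transDeriv φ (T.map v)).comp (paramDeriv T.map v)) v :=
  transDeriv_comp hφ h ((T.contMDiffOn.contMDiffAt (T.isOpen_dom.mem_nhds hv)).mdifferentiableAt
    (by simp))

/-- The derivative of a holonomy map is given by the parallel fields along the paths along which it
slides. -/
theorem IsHolonomyMap.exists_isParallel {T T' : ℱ.Transversal} {γ : Euc q → Euc q}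
    {H : Euc q → I → M} (h : ℱ.IsHolonomyMap T T' γ H) {a : Euc q} (ha : a ∈ T.dom) (ξ : Euc q) :
    ∃ w : I → Euc (p + q), ℱ.IsParallel (H a) w ∧
      (∀ φ ∈ ℱ.charts, T.map a ∈ φ.source →
        transDeriv φ (T.map a) (w 0) = transDeriv φ (T.map a) (T.deriv a ξ)) ∧
      ∀ ψ ∈ ℱ.charts, T'.map (γ a) ∈ ψ.source → transDeriv ψ (T'.map (γ a)) (w 1) =
        transDeriv ψ (T'.map (γ a)) (T'.deriv (γ a) (fderiv ℝ γ a ξ)) := by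
  have hD : T.dom ∈ 𝓝 a := T.isOpen_dom.mem_nhds ha
  have h0 : H a 0 = T.map a := h.source a ha
  have h1 : H a 1 = T'.map (γ a) := h.target a ha
  have hd0 : ∀ φ ∈ ℱ.charts, T.map a ∈ φ.source → HasFDerivAt (fun v => (φ (H v 0)).2)
      ((transDeriv φ (T.map a)).comp (paramDeriv T.map a)) a := fun φ hφ hs =>
    (transDeriv_deriv ha hφ hs).congr_of_eventuallyEq <| by
      filter_upwards [hD] with v hv
      rw [h.source v hv]
  have hγ : DifferentiableAt ℝ γ a := (h.contDiffOn.contDiffAt hD).differentiableAt (by simp)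
  obtain ⟨φ, hφ, hs⟩ := ℱ.covers (T.map a)
  obtain ⟨w, hw, hw'⟩ := exists_isParallel_of_family hD h.continuousOn h.leafPath hφ
    (by rwa [h0]) (hd0 φ hφ hs).differentiableAt ξ
  refine ⟨w, hw, fun ψ hψ hs => ?_, fun ψ hψ hs => ?_⟩
  · have := hw' 0 ψ hψ (by rwa [h0])
    rw [(hd0 ψ hψ hs).fderiv, h0] at this
    exact this
  · have := hw' 1 ψ hψ (by rwa [h1])
    have hd1 : HasFDerivAt (fun v => (ψ (H v 1)).2)
        (((transDeriv ψ (T'.map (γ a))).comp (paramDeriv T'.map (γ a))).comp (fderiv ℝ γ a)) a := by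
      refine (HasFDerivAt.comp a (transDeriv_deriv (h.mapsTo ha) hψ hs)
        hγ.hasFDerivAt).congr_of_eventuallyEq ?_
      filter_upwards [hD] with v hv
      simp [h.target v hv]
    rw [hd1.fderiv, h1] at this
    exact this

end Vertical

/-- Orthogonal projection along a subspace for a positive definite bilinear form. -/
theorem exists_sub_mem_forall_eq_zero {V : Type*} [AddCommGroup V] [Module ℝ V]
    [FiniteDimensional ℝ V] (B : V →ₗ[ℝ] V →ₗ[ℝ] ℝ) (hs : ∀ v w, B v w = B w v)
    (hp : ∀ v, v ≠ 0 → 0 < B v v) (W : Submodule ℝ V) (v : V) :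
    ∃ u, u - v ∈ W ∧ ∀ w ∈ W, B w u = 0 := by
  have hr : LinearMap.BilinForm.IsRefl B := fun x y h => by rw [hs, h]
  have hnd : (LinearMap.BilinForm.restrict B W).Nondegenerate := by
    have hz : ∀ w : W, (LinearMap.BilinForm.restrict B W) w w = 0 → w = 0 := by
      intro w hw
      by_contra hne
      exact (hp w (by simpa using hne)).ne' hw
    exact ⟨fun w hw => hz w (hw w), fun w hw => hz w (hw w)⟩
  have hc := LinearMap.BilinForm.isCompl_orthogonal_of_restrict_nondegenerate hr hnd
  have hv : v ∈ W ⊔ LinearMap.BilinForm.orthogonal B W := hc.sup_eq_top ▸ Submodule.mem_top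
  obtain ⟨w, hw, u, hu, rfl⟩ := Submodule.mem_sup.1 hv
  exact ⟨u, by simpa using hw, fun w' hw' => hu w' hw'⟩

section Normal

variable {p q : ℕ} {M : Type*} [TopologicalSpace M] [ChartedSpace (Euc (p + q)) M]
  [IsManifold (𝓡 (p + q)) ∞ M]
  {ℱ : Foliation p q M} {φ ψ : OpenPartialHomeomorph M (Euc p × Euc q)} {x y : M}
  {k : ContMDiffRiemannianMetric (𝓡 (p + q)) ∞ (Euc (p + q))
      (fun x : M => TangentSpace (𝓡 (p + q)) x)}

theorem mem_normalSpace_iff {u : TangentSpace (𝓡 (p + q)) x} :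
    u ∈ ℱ.normalSpace k x ↔ ∀ w ∈ ℱ.leafTangent x, k.inner x w u = 0 := by
  simp [normalSpace, Submodule.mem_iInf]

theorem bijective_transDeriv_normalSpace (hφ : φ ∈ ℱ.charts) (hx : x ∈ φ.source) :
    Function.Bijective (fun u : ℱ.normalSpace k x => transDeriv φ x u.1) := by
  constructor
  · intro u u' h
    have h1 : u.1 - u'.1 ∈ ℱ.leafTangent x := (sub_mem_leafTangent_iff hφ hx _ _).2 h
    have h2 := mem_normalSpace_iff.1 (u - u').2 _ h1
    by_contra hne
    exact (k.pos x (u.1 - u'.1) (fun h => hne (Subtype.ext (sub_eq_zero.1 h)))).ne' h2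
  · intro ξ
    obtain ⟨v, hv⟩ := transDeriv_surjective hφ hx ξ
    have : FiniteDimensional ℝ (TangentSpace (𝓡 (p + q)) x) :=
      inferInstanceAs (FiniteDimensional ℝ (Euc (p + q)))
    let B : TangentSpace (𝓡 (p + q)) x →ₗ[ℝ] TangentSpace (𝓡 (p + q)) x →ₗ[ℝ] ℝ :=
      LinearMap.mk₂ ℝ (fun v w => k.inner x v w) (by simp) (by simp) (by simp) (by simp)
    obtain ⟨u, hu, hu'⟩ := exists_sub_mem_forall_eq_zero B (fun v w => k.symm x v w)
      (fun v hv => k.pos x v hv) (ℱ.leafTangent x) v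
    exact ⟨⟨u, mem_normalSpace_iff.2 hu'⟩, ((sub_mem_leafTangent_iff hφ hx _ _).1 hu).trans hv⟩

/-- The identification of the normal space at `x` with `ℝ^q` given by a foliated chart. -/
noncomputable def normalEquiv (k : ContMDiffRiemannianMetric (𝓡 (p + q)) ∞ (Euc (p + q))
      (fun x : M => TangentSpace (𝓡 (p + q)) x)) (hφ : φ ∈ ℱ.charts) (hx : x ∈ φ.source) :
    ℱ.normalSpace k x ≃ₗ[ℝ] Euc q :=
  LinearEquiv.ofBijective
    { toFun := fun u => transDeriv φ x u.1
      map_add' := fun u v => (transDeriv φ x).map_add u.1 v.1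
      map_smul' := fun r u => (transDeriv φ x).map_smul r u.1 }
    (bijective_transDeriv_normalSpace hφ hx)

theorem normalEquiv_apply (hφ : φ ∈ ℱ.charts) (hx : x ∈ φ.source) (u : ℱ.normalSpace k x) :
    normalEquiv k hφ hx u = transDeriv φ x u.1 := rfl

/-- Every tangent vector is congruent to a normal one modulo the tangent space of the leaf. -/
theorem exists_normalSpace_transDeriv_eq (w : Euc (p + q)) :
    ∃ u : ℱ.normalSpace k x, ∀ φ ∈ ℱ.charts, x ∈ φ.source →
      transDeriv φ x u.1 = transDeriv φ x w := by
  obtain ⟨φ, hφ, hx⟩ := ℱ.covers x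
  obtain ⟨u, hu⟩ := (bijective_transDeriv_normalSpace (k := k) hφ hx).2 (transDeriv φ x w)
  refine ⟨u, fun ψ hψ hx' => ?_⟩
  obtain ⟨A, hA⟩ := exists_transDeriv_eq_comp hφ hψ hx hx'
  rw [hA]
  exact congrArg A hu

/-- An infinitesimal holonomy is the parallel transport of the Bott connection. -/
theorem IsInfinitesimalHolonomy.exists_isParallel {c : Path x y}
    {h : ℱ.normalSpace k x →ₗ[ℝ] ℱ.normalSpace k y} (hh : ℱ.IsInfinitesimalHolonomy k c h)
    (u : ℱ.normalSpace k x) :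
    ∃ w : I → Euc (p + q), ℱ.IsParallel c w ∧
      (∀ φ ∈ ℱ.charts, x ∈ φ.source → transDeriv φ x (w 0) = transDeriv φ x u.1) ∧
      ∀ ψ ∈ ℱ.charts, y ∈ ψ.source → transDeriv ψ y (w 1) = transDeriv ψ y (h u).1 := by
  obtain ⟨T, T', γ, H, a, hx, hy, hol, ha, hc, hu⟩ := hh
  subst hx hy
  obtain ⟨ξ, hξ⟩ : ∃ ξ, T.deriv a ξ - u.1 ∈ ℱ.leafTangent (T.map a) := by
    have h1 : u.1 ∈ _ ⊔ ℱ.leafTangent (T.map a) := T.transverse a ha ▸ Submodule.mem_top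
    obtain ⟨_, ⟨ξ, rfl⟩, l, hl, he⟩ := Submodule.mem_sup.1 h1
    refine ⟨ξ, ?_⟩
    rw [← he, ← neg_mem_iff]
    convert hl using 1
    rw [neg_sub]
    exact add_sub_cancel_left _ l
  obtain ⟨w, hw, hw0, hw1⟩ := hol.exists_isParallel ha ξ
  have hcH : H a = c := funext hc
  refine ⟨w, hcH ▸ hw, fun φ hφ hs => ?_, fun ψ hψ hs => ?_⟩
  · rw [hw0 φ hφ hs]
    exact (sub_mem_leafTangent_iff hφ hs _ _).1 hξ
  · rw [hw1 ψ hψ hs]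
    exact (sub_mem_leafTangent_iff hψ hs _ _).1 (hu u ξ hξ)

/-- A holonomy map starting on a transversal whose parametrization is compatible with a foliated
chart induces an infinitesimal holonomy. -/
theorem IsHolonomyMap.exists_isInfinitesimalHolonomy {T T' : ℱ.Transversal} {γ : Euc q → Euc q}
    {H : Euc q → I → M} (h : ℱ.IsHolonomyMap T T' γ H) {a : Euc q} (ha : a ∈ T.dom)
    (hφ : φ ∈ ℱ.charts) (hs : T.map a ∈ φ.source)
    (hT : ∀ ξ, transDeriv φ (T.map a) (T.deriv a ξ) = ξ) (hx : T.map a = x)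
    (hy : T'.map (γ a) = y) (c : Path x y) (hc : ∀ t, H a t = c t) :
    ∃ h : ℱ.normalSpace k x →ₗ[ℝ] ℱ.normalSpace k y, ℱ.IsInfinitesimalHolonomy k c h := by
  subst hx hy
  obtain ⟨ψ, hψ, hs'⟩ := ℱ.covers (T'.map (γ a))
  let A : Euc q →L[ℝ] Euc q :=
    ((transDeriv ψ (T'.map (γ a))).comp (paramDeriv T'.map (γ a))).comp (fderiv ℝ γ a)
  refine ⟨(normalEquiv k hψ hs').symm.toLinearMap ∘ₗ A.toLinearMap ∘ₗ
    (normalEquiv k hφ hs).toLinearMap, T, T', γ, H, a, rfl, rfl, h, ha, hc, fun u ξ hξ => ?_⟩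
  rw [sub_mem_leafTangent_iff hφ hs] at hξ
  rw [sub_mem_leafTangent_iff hψ hs']
  have h1 : normalEquiv k hφ hs u = ξ := hξ.symm.trans (hT ξ)
  have h2 := normalEquiv_apply hψ hs' ((normalEquiv k hψ hs').symm (A ξ))
  rw [LinearEquiv.apply_symm_apply] at h2
  change A ξ = transDeriv ψ _ ((normalEquiv k hψ hs').symm (A (normalEquiv k hφ hs u))).1
  rw [h1]
  exact h2

/-- The coefficients, in the frame given by a foliated chart, of a field of bilinear forms smooth
over the open set `U`, are continuous. -/
theorem continuousOn_form_paramDeriv (hφ : φ ∈ ℱ.charts) {U : Set M}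
    {B : ∀ x : M, TangentSpace (𝓡 (p + q)) x →L[ℝ] TangentSpace (𝓡 (p + q)) x →L[ℝ] ℝ}
    (hB : ContMDiffOn (𝓡 (p + q))
      ((𝓡 (p + q)).prod 𝓘(ℝ, Euc (p + q) →L[ℝ] Euc (p + q) →L[ℝ] ℝ)) ∞
      (fun x => TotalSpace.mk' (Euc (p + q) →L[ℝ] Euc (p + q) →L[ℝ] ℝ)
        (E := fun x : M => TangentSpace (𝓡 (p + q)) x →L[ℝ] TangentSpace (𝓡 (p + q)) x →L[ℝ] ℝ)
        x (B x)) U) :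
    ContinuousOn (fun z : (Euc p × Euc q) × (Euc p × Euc q) =>
        B (φ.symm z.1) (paramDeriv φ.symm z.1 z.2) (paramDeriv φ.symm z.1 z.2))
      ((φ.target ∩ φ.symm ⁻¹' U) ×ˢ univ) := by
  have hsub : φ.target ∩ φ.symm ⁻¹' U ⊆ φ.target := inter_subset_left
  have hX : ContinuousOn (fun z : (Euc p × Euc q) × (Euc p × Euc q) =>
      (TotalSpace.mk' (Euc (p + q)) (E := fun x : M => TangentSpace (𝓡 (p + q)) x)
        (φ.symm z.1) (paramDeriv φ.symm z.1 z.2))) ((φ.target ∩ φ.symm ⁻¹' U) ×ˢ univ) := by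
    have h1 := (ℱ.contMDiffOn_symm φ hφ).continuousOn_tangentMapWithin (by simp)
      φ.open_target.uniqueMDiffOn
    have h2 := (tangentBundleModelSpaceHomeomorph 𝓘(ℝ, Euc p × Euc q)).symm.continuous
    refine (h1.comp (h2.continuousOn (s := (φ.target ∩ φ.symm ⁻¹' U) ×ˢ univ)) ?_).congr ?_
    · rintro ⟨z, e⟩ ⟨hz, -⟩
      exact hsub hz
    · rintro ⟨z, e⟩ ⟨hz, -⟩
      have : mfderivWithin 𝓘(ℝ, Euc p × Euc q) (𝓡 (p + q)) φ.symm φ.target z =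
          mfderiv 𝓘(ℝ, Euc p × Euc q) (𝓡 (p + q)) φ.symm z :=
        mfderivWithin_of_isOpen φ.open_target (hsub hz)
      change TotalSpace.mk' _ _ _ = TotalSpace.mk' _ (φ.symm z)
        (mfderivWithin 𝓘(ℝ, Euc p × Euc q) (𝓡 (p + q)) φ.symm φ.target z e)
      rw [this]
      rfl
  have hX' : ContMDiffOn (𝓘(ℝ, (Euc p × Euc q) × (Euc p × Euc q))) ((𝓡 (p + q)).prod (𝓡 (p + q))) 0
      (fun z : (Euc p × Euc q) × (Euc p × Euc q) =>
      (TotalSpace.mk' (Euc (p + q)) (E := fun x : M => TangentSpace (𝓡 (p + q)) x)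
        (φ.symm z.1) (paramDeriv φ.symm z.1 z.2))) ((φ.target ∩ φ.symm ⁻¹' U) ×ˢ univ) :=
    contMDiffOn_zero_iff.2 hX
  have hb : ContinuousOn (fun z : (Euc p × Euc q) × (Euc p × Euc q) => φ.symm z.1)
      ((φ.target ∩ φ.symm ⁻¹' U) ×ˢ univ) :=
    φ.continuousOn_symm.comp continuousOn_fst (fun z hz => hsub hz.1)
  have hB' : ContMDiffOn (𝓘(ℝ, (Euc p × Euc q) × (Euc p × Euc q)))
      ((𝓡 (p + q)).prod 𝓘(ℝ, Euc (p + q) →L[ℝ] Euc (p + q) →L[ℝ] ℝ)) 0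
      (fun z : (Euc p × Euc q) × (Euc p × Euc q) =>
        TotalSpace.mk' (Euc (p + q) →L[ℝ] Euc (p + q) →L[ℝ] ℝ)
        (E := fun x : M => TangentSpace (𝓡 (p + q)) x →L[ℝ] TangentSpace (𝓡 (p + q)) x →L[ℝ] ℝ)
        (φ.symm z.1) (B (φ.symm z.1))) ((φ.target ∩ φ.symm ⁻¹' U) ×ˢ univ) :=
    contMDiffOn_zero_iff.2 (hB.continuousOn.comp hb (fun z hz => hz.1.2))
  have := ContMDiffOn.clm_bundle_apply₂ (F₁ := Euc (p + q)) (F₂ := Euc (p + q)) (F₃ := ℝ)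
    (E₃ := fun _ : M => ℝ) hB' hX' hX'
  have h3 := this.continuousOn
  have h4 := (Bundle.Trivial.homeomorphProd M ℝ).continuous.comp_continuousOn h3
  exact continuous_snd.comp_continuousOn h4

end Normal

end Foliation

/-! ### Boxes and uniform estimates -/

namespace Foliation

section Quadratic

variable {V : Type*} [AddCommGroup V] [Module ℝ V] [TopologicalSpace V]

/-- For a positive semidefinite form, translation by an isotropic vector does not change the
quadratic form. -/
theorem apply_self_eq_of_sub_isotropic (B : V →L[ℝ] V →L[ℝ] ℝ) (hs : ∀ v w, B v w = B w v)
    (h0 : ∀ v, 0 ≤ B v v) {v w : V} (h : B (v - w) (v - w) = 0) : B v v = B w w := by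
  set l := v - w
  have hl : B l w = 0 := by
    by_contra hne
    have h1 := h0 (w + (-(B w w + 1) / (2 * B l w)) • l)
    simp only [map_add, map_smul, add_apply, smul_apply, smul_eq_mul, h, hs w l] at h1
    have h2 : -(B w w + 1) / (2 * B l w) * (B l w) = -(B w w + 1) / 2 := by
      field_simp
    linarith
  have hv : v = w + l := by simp [l]
  rw [hv]
  simp only [map_add, add_apply, h, hs w l, hl]
  ring

theorem apply_self_le_of_orthogonal (B : V →L[ℝ] V →L[ℝ] ℝ) (hs : ∀ v w, B v w = B w v)
    (h0 : ∀ v, 0 ≤ B v v) {u v : V} (h : B (v - u) u = 0) : B u u ≤ B v v := by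
  have h1 : B v v = B u u + B (v - u) (v - u) := by
    generalize hl : v - u = l at h ⊢
    obtain rfl : v = u + l := by rw [← hl, add_sub_cancel]
    simp only [map_add, add_apply, hs u l, h]
    ring
  linarith [h0 (v - u)]

/-- Over a compact set, a continuous family of positive definite quadratic forms is comparable to
the square of the norm. -/
theorem eventually_quadratic_comparable {Z E : Type*} [TopologicalSpace Z] [NormedAddCommGroup E]
    [NormedSpace ℝ E] [ProperSpace E] {K : Set Z} (hK : IsCompact K) {f : Z × E → ℝ}
    (hf : ContinuousOn f (K ×ˢ univ)) (hh : ∀ z ∈ K, ∀ (r : ℝ) e, f (z, r • e) = r ^ 2 * f (z, e))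
    (hpos : ∀ z ∈ K, ∀ e, e ≠ 0 → 0 < f (z, e)) :
    ∀ᶠ C in atTop, ∀ z ∈ K, ∀ e, f (z, e) ≤ C * ‖e‖ ^ 2 ∧ ‖e‖ ^ 2 ≤ C * f (z, e) := by
  have hS : IsCompact (K ×ˢ Metric.sphere (0 : E) 1) := hK.prod (isCompact_sphere 0 1)
  have hfS : ContinuousOn f (K ×ˢ Metric.sphere (0 : E) 1) :=
    hf.mono (prod_mono_right (subset_univ _))
  have hfpos : ∀ x ∈ K ×ˢ Metric.sphere (0 : E) 1, 0 < f x := fun x hx =>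
    hpos x.1 hx.1 x.2 (by rintro h; simpa [h] using hx.2)
  obtain ⟨C₁, h1⟩ := hS.exists_bound_of_continuousOn hfS
  obtain ⟨C₂, h2⟩ := hS.exists_bound_of_continuousOn
    (hfS.inv₀ (fun x hx => (hfpos x hx).ne'))
  filter_upwards [eventually_ge_atTop C₁, eventually_ge_atTop C₂] with C hC₁ hC₂ z hz e
  rcases eq_or_ne e 0 with rfl | he
  · have := hh z hz 0 0
    simp at this
    simp [this]
  · have hn : 0 < ‖e‖ := norm_pos_iff.2 he
    have hmem : (z, ‖e‖⁻¹ • e) ∈ K ×ˢ Metric.sphere (0 : E) 1 :=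
      ⟨hz, by simp [norm_smul, hn.ne']⟩
    have hfe : f (z, e) = ‖e‖ ^ 2 * f (z, ‖e‖⁻¹ • e) := by
      rw [← hh z hz, smul_smul, mul_inv_cancel₀ hn.ne', one_smul]
    have hp := hfpos _ hmem
    have ha := (le_abs_self _).trans ((h1 _ hmem).trans hC₁)
    have hb := (le_abs_self _).trans ((h2 _ hmem).trans hC₂)
    replace hb := (inv_le_iff_one_le_mul₀ hp).1 hb
    rw [hfe]
    have hn2 : 0 ≤ ‖e‖ ^ 2 := by positivity
    constructor
    · nlinarith
    · nlinarith

end Quadratic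

variable {p q : ℕ} {M : Type*} [TopologicalSpace M] [ChartedSpace (Euc (p + q)) M]

/-- Injectivity comes from the chart being a left inverse, surjectivity from the dimensions. -/
theorem paramDeriv_symm_bijective {ℱ : Foliation p q M}
    {φ : OpenPartialHomeomorph M (Euc p × Euc q)} (hφ : φ ∈ ℱ.charts) {z : Euc p × Euc q}
    (hz : z ∈ φ.target) : Function.Bijective (paramDeriv (p := p) (q := q) φ.symm z) := by
  have hinj : Function.Injective (paramDeriv (p := p) (q := q) φ.symm z) := by
    have h1 : HasMFDerivAt 𝓘(ℝ, Euc p × Euc q) 𝓘(ℝ, Euc p × Euc q) (φ ∘ φ.symm) z _ :=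
      (mdifferentiableAt_chart hφ (φ.map_target hz)).hasMFDerivAt.comp z
        (mdifferentiableAt_symm hφ hz).hasMFDerivAt
    have h2 : HasMFDerivAt 𝓘(ℝ, Euc p × Euc q) 𝓘(ℝ, Euc p × Euc q) (φ ∘ φ.symm) z
        (ContinuousLinearMap.id ℝ (Euc p × Euc q)) := by
      refine (hasMFDerivAt_id z).congr_of_eventuallyEq ?_
      filter_upwards [φ.open_target.mem_nhds hz] with w hw
      simp [φ.right_inv hw]
    have h3 := h1.mfderiv.symm.trans h2.mfderiv
    intro e e' he
    have h4 : ∀ e : Euc p × Euc q, (mfderiv (𝓡 (p + q)) 𝓘(ℝ, Euc p × Euc q) φ (φ.symm z) :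
        Euc (p + q) → Euc p × Euc q) (paramDeriv (p := p) (q := q) φ.symm z e) = e := fun e => by
      exact congrArg (fun L : (Euc p × Euc q) →L[ℝ] (Euc p × Euc q) => L e) h3
    rw [← h4 e, he, h4 e']
  refine ⟨hinj, ?_⟩
  exact (LinearMap.injective_iff_surjective_of_finrank_eq_finrank
    (f := (paramDeriv (p := p) (q := q) φ.symm z).toLinearMap) (by simp)).1 hinj

variable [IsManifold (𝓡 (p + q)) ∞ M] {ℱ : Foliation p q M}

/-- A foliated chart together with a ball in its target, of twice a given radius, whose closure is
still in the target, and a metric of the similarity structure defined over this closed ball. -/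
structure Box (S : ℱ.TransverseSimilarityStructure) where
  chart : OpenPartialHomeomorph M (Euc p × Euc q)
  chart_mem : chart ∈ ℱ.charts
  metric : ℱ.LocalTransverseMetric
  metric_mem : metric ∈ S.metrics
  center : Euc p × Euc q
  radius : ℝ
  radius_pos : 0 < radius
  subset_target : Metric.closedBall center (2 * radius) ⊆ chart.target
  subset_dom : ∀ z ∈ Metric.closedBall center (2 * radius), chart.symm z ∈ metric.dom

namespace Box

variable {S : ℱ.TransverseSimilarityStructure}

/-- The part of `M` over the ball of the given radius. -/
def inner (b : Box S) : Set M := b.chart.source ∩ b.chart ⁻¹' Metric.ball b.center b.radius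

/-- The part of `M` over the closed ball of twice the given radius. -/
def outer (b : Box S) : Set M :=
  b.chart.source ∩ b.chart ⁻¹' Metric.closedBall b.center (2 * b.radius)

theorem isOpen_inner (b : Box S) : IsOpen b.inner :=
  b.chart.isOpen_inter_preimage Metric.isOpen_ball

theorem inner_subset_outer (b : Box S) : b.inner ⊆ b.outer := fun _ hx =>
  ⟨hx.1, Metric.ball_subset_closedBall (Metric.ball_subset_ball
    (by linarith [b.radius_pos]) hx.2)⟩

theorem symm_mem_outer (b : Box S) {z : Euc p × Euc q}
    (hz : z ∈ Metric.closedBall b.center (2 * b.radius)) : b.chart.symm z ∈ b.outer :=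
  ⟨b.chart.map_target (b.subset_target hz), by
    simpa [b.chart.right_inv (b.subset_target hz)] using hz⟩

theorem exists_symm_eq (b : Box S) {x : M} (hx : x ∈ b.outer) :
    ∃ z ∈ Metric.closedBall b.center (2 * b.radius), b.chart.symm z = x :=
  ⟨b.chart x, hx.2, b.chart.left_inv hx.1⟩

theorem exists_mem_inner (S : ℱ.TransverseSimilarityStructure) (x : M) :
    ∃ b : Box S, x ∈ b.inner := by
  obtain ⟨φ, hφ, hx⟩ := ℱ.covers x
  obtain ⟨g, hg, hx'⟩ := S.covers x
  have h1 : ∀ᶠ z in 𝓝 (φ x), z ∈ φ.target ∧ φ.symm z ∈ g.dom := by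
    refine Eventually.and (φ.open_target.mem_nhds (φ.map_source hx)) ?_
    exact (φ.continuousAt_symm (φ.map_source hx)).eventually
      (g.isOpen_dom.mem_nhds (by rwa [φ.left_inv hx]))
  obtain ⟨r, hr, h⟩ := Metric.nhds_basis_closedBall.eventually_iff.1 h1
  exact ⟨⟨φ, hφ, g, hg, φ x, r / 2, by positivity,
    fun z hz => (h (by simpa [mul_div_cancel₀] using hz)).1,
    fun z hz => (h (by simpa [mul_div_cancel₀] using hz)).2⟩, hx,
    Metric.mem_ball_self (by positivity)⟩

theorem eventually_form_comparable (b : Box S) :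
    ∀ᶠ C in atTop, ∀ x ∈ b.outer, ∀ w : Euc (p + q),
      b.metric.form x w w ≤ C * ‖transDeriv b.chart x w‖ ^ 2 ∧
      ‖transDeriv b.chart x w‖ ^ 2 ≤ C * b.metric.form x w w := by
  have hK := isCompact_closedBall b.center (2 * b.radius)
  have hc : ContinuousOn (fun z : (Euc p × Euc q) × Euc q => b.metric.form (b.chart.symm z.1)
      (paramDeriv b.chart.symm z.1 (0, z.2)) (paramDeriv b.chart.symm z.1 (0, z.2)))
      (Metric.closedBall b.center (2 * b.radius) ×ˢ univ) :=
    (continuousOn_form_paramDeriv b.chart_mem b.metric.contMDiffOn).comp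
      (f := fun z : (Euc p × Euc q) × Euc q => (z.1, ((0 : Euc p), z.2)))
      (by fun_prop) (fun z hz => ⟨⟨b.subset_target hz.1, b.subset_dom _ hz.1⟩, mem_univ _⟩)
  refine (eventually_quadratic_comparable hK hc ?_ ?_).mono fun C hC x hx w => ?_
  · intro z hz r e
    have h1 : ((0 : Euc p), r • e) = r • ((0 : Euc p), e) := by simp
    simp only [h1, map_smul]
    generalize paramDeriv (p := p) (q := q) b.chart.symm z (0, e) = w
    have h2 := (b.metric.form (b.chart.symm z)).map_smul r w
    have h3 := (b.metric.form (b.chart.symm z) w).map_smul r w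
    refine (congrArg (fun L : TangentSpace (𝓡 (p + q)) (b.chart.symm z) →L[ℝ] ℝ => L (r • w))
      h2).trans ?_
    refine (congrArg (r * ·) h3).trans ?_
    simp only [smul_eq_mul]
    ring
  · intro z hz e he
    refine lt_of_le_of_ne (b.metric.nonneg _ (b.subset_dom z hz) _) (fun h => he ?_)
    have h1 := (b.metric.eq_zero_iff _ (b.subset_dom z hz) _).1 h.symm
    have h2 := (mem_leafTangent_iff b.chart_mem (b.chart.map_target (b.subset_target hz)) _).1 h1
    rwa [transDeriv_symm b.chart_mem (b.subset_target hz)] at h2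
  · obtain ⟨z, hz, rfl⟩ := b.exists_symm_eq hx
    have h1 := hC z hz (transDeriv b.chart (b.chart.symm z) w)
    have h2 := transDeriv_symm b.chart_mem (b.subset_target hz)
      (0, transDeriv b.chart (b.chart.symm z) w)
    have hxd := b.subset_dom z hz
    have h3 : b.metric.form (b.chart.symm z) w w = _ :=
      apply_self_eq_of_sub_isotropic (b.metric.form (b.chart.symm z))
        (b.metric.symm _ hxd) (b.metric.nonneg _ hxd) ((b.metric.eq_zero_iff _ hxd _).2
        ((sub_mem_leafTangent_iff b.chart_mem hx.1 _ _).2 h2.symm))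
    rw [h3]
    exact h1

theorem eventually_inner_comparable (b : Box S)
    (k : ContMDiffRiemannianMetric (𝓡 (p + q)) ∞ (Euc (p + q))
      (fun x : M => TangentSpace (𝓡 (p + q)) x)) :
    ∀ᶠ C in atTop, ∀ x ∈ b.outer, ∀ u : ℱ.normalSpace k x,
      k.inner x u u ≤ C * ‖transDeriv b.chart x u.1‖ ^ 2 ∧
      ‖transDeriv b.chart x u.1‖ ^ 2 ≤ C * k.inner x u u := by
  have hK := isCompact_closedBall b.center (2 * b.radius)
  have hc := (continuousOn_form_paramDeriv b.chart_mem
    (k.contMDiff.contMDiffOn (s := univ))).mono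
    (fun z (hz : z ∈ Metric.closedBall b.center (2 * b.radius) ×ˢ (univ : Set (Euc p × Euc q))) =>
      ⟨⟨b.subset_target hz.1, mem_univ _⟩, mem_univ _⟩)
  refine (eventually_quadratic_comparable hK hc ?_ ?_).mono fun C hC x hx u => ?_
  · intro z hz r e
    simp only [map_smul]
    generalize paramDeriv (p := p) (q := q) b.chart.symm z e = w
    have h2 := (k.inner (b.chart.symm z)).map_smul r w
    have h3 := (k.inner (b.chart.symm z) w).map_smul r w
    refine (congrArg (fun L : TangentSpace (𝓡 (p + q)) (b.chart.symm z) →L[ℝ] ℝ => L (r • w))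
      h2).trans ?_
    refine (congrArg (r * ·) h3).trans ?_
    simp only [smul_eq_mul]
    ring
  · intro z hz e he
    refine k.pos _ _ (fun h => he ?_)
    exact (paramDeriv_symm_bijective b.chart_mem (b.subset_target hz)).1 (h.trans (map_zero _).symm)
  · obtain ⟨z, hz, rfl⟩ := b.exists_symm_eq hx
    constructor
    · have h1 := (hC z hz (0, transDeriv b.chart (b.chart.symm z) u.1)).1
      have h2 := transDeriv_symm b.chart_mem (b.subset_target hz)
        (0, transDeriv b.chart (b.chart.symm z) u.1)
      have h3 := apply_self_le_of_orthogonal (k.inner (b.chart.symm z)) (k.symm _)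
        (fun v => (em (v = 0)).elim (fun h => by simp [h]) (fun h => (k.pos _ v h).le))
        (mem_normalSpace_iff.1 u.2 _ ((sub_mem_leafTangent_iff b.chart_mem hx.1 _ _).2 h2))
      refine h3.trans (h1.trans_eq ?_)
      simp [Prod.norm_def]
    · obtain ⟨e, he⟩ := (paramDeriv_symm_bijective b.chart_mem (b.subset_target hz)).2 u.1
      have h1 := (hC z hz e).2
      have h2 := transDeriv_symm b.chart_mem (b.subset_target hz) e
      rw [he] at h1 h2
      rw [h2]
      refine le_trans ?_ h1
      gcongr
      exact norm_snd_le e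

/-- Points of `b` at distance less than `ε` of `m`, in the chart of `b`, are sent by the change of
charts into a convex subset of the larger ball of `b'`, whose plaques lie in plaques of `b`. -/
def IsUniform (b b' : Box S) (ε : ℝ) (m : M) : Prop :=
  ∃ K : Set (Euc p × Euc q), Convex ℝ K ∧ K ⊆ Metric.ball (b'.chart m) b'.radius ∧
    K ⊆ b'.chart.target ∧ (∀ z ∈ K, b'.chart.symm z ∈ b.chart.source) ∧
    ∀ z ∈ Metric.ball (b.chart m) ε, z ∈ b.chart.target ∧ b.chart.symm z ∈ b'.chart.source ∧
      b'.chart (b.chart.symm z) ∈ K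

theorem eventually_isUniform [T2Space M] [CompactSpace M] (b b' : Box S) :
    ∀ᶠ ε in 𝓝 (0 : ℝ), ∀ m ∈ b.inner ∩ b'.inner, IsUniform b b' ε m := by
  have hcl : ∀ b : Box S,
      IsClosed (b.chart.source ∩ b.chart ⁻¹' Metric.closedBall b.center b.radius) ∧
      b.inner ⊆ b.chart.source ∩ b.chart ⁻¹' Metric.closedBall b.center b.radius := by
    intro b
    refine ⟨?_, fun x hx => ⟨hx.1, Metric.ball_subset_closedBall hx.2⟩⟩
    have hsub : Metric.closedBall b.center b.radius ⊆ b.chart.target :=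
      (Metric.closedBall_subset_closedBall (by linarith [b.radius_pos])).trans b.subset_target
    rw [← b.chart.symm_image_eq_source_inter_preimage hsub]
    exact ((isCompact_closedBall _ _).image_of_continuousOn
      (b.chart.continuousOn_symm.mono hsub)).isClosed
  have key := isCompact_univ.eventually_forall_of_forall_eventually (x₀ := (0 : ℝ))
    (K := (univ : Set M)) (P := fun ε m => m ∈ b.inner ∩ b'.inner → IsUniform b b' ε m)
    (fun m₀ _ => ?_)
  · exact key.mono fun ε h m hm => h m (mem_univ m) hm
  -- the closed sets containing `b.inner` and `b'.inner` reduce the question to points lying in the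
  -- domains of both charts
  by_cases hb : m₀ ∈ b.chart.source ∩ b.chart ⁻¹' Metric.closedBall b.center b.radius
  swap
  · filter_upwards [continuousAt_snd.eventually
      ((hcl b).1.isOpen_compl.mem_nhds hb)] with z hz h
    exact (hz ((hcl b).2 h.1)).elim
  by_cases hb' : m₀ ∈ b'.chart.source ∩ b'.chart ⁻¹' Metric.closedBall b'.center b'.radius
  swap
  · filter_upwards [continuousAt_snd.eventually
      ((hcl b').1.isOpen_compl.mem_nhds hb')] with z hz h
    exact (hz ((hcl b').2 h.2)).elim
  have hm : b.chart.symm (b.chart m₀) = m₀ := b.chart.left_inv hb.1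
  have hm' : b'.chart.symm (b'.chart m₀) = m₀ := b'.chart.left_inv hb'.1
  have hK : ∀ᶠ z in 𝓝 (b'.chart m₀), z ∈ b'.chart.target ∧ b'.chart.symm z ∈ b.chart.source := by
    refine Eventually.and (b'.chart.open_target.mem_nhds (b'.chart.map_source hb'.1)) ?_
    exact (b'.chart.continuousAt_symm (b'.chart.map_source hb'.1)).eventually
      (b.chart.open_source.mem_nhds (by rw [hm']; exact hb.1))
  obtain ⟨ρ, hρ, hKρ⟩ := Metric.nhds_basis_ball.eventually_iff.1 hK
  set r := min ρ (b'.radius / 2) with hr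
  have hr0 : 0 < r := lt_min hρ (half_pos b'.radius_pos)
  have hcs : ContinuousAt b.chart.symm (b.chart m₀) :=
    b.chart.continuousAt_symm (b.chart.map_source hb.1)
  have hN : ∀ᶠ z in 𝓝 (b.chart m₀), z ∈ b.chart.target ∧ b.chart.symm z ∈ b'.chart.source ∧
      b'.chart (b.chart.symm z) ∈ Metric.ball (b'.chart m₀) r := by
    refine Eventually.and (b.chart.open_target.mem_nhds (b.chart.map_source hb.1))
      ((hcs.eventually (b'.chart.open_source.mem_nhds (by rw [hm]; exact hb'.1))).and ?_)
    have h1 : ContinuousAt b'.chart (b.chart.symm (b.chart m₀)) := by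
      rw [hm]; exact b'.chart.continuousAt hb'.1
    refine (h1.comp hcs).eventually ?_
    simp only [Function.comp, hm]
    exact Metric.ball_mem_nhds _ hr0
  obtain ⟨η, hη, hNη⟩ := Metric.nhds_basis_ball.eventually_iff.1 hN
  have e1 : ∀ᶠ z : ℝ × M in 𝓝 (0, m₀), z.1 < η / 2 :=
    continuousAt_fst.eventually (gt_mem_nhds (half_pos hη))
  have e2 : ∀ᶠ z : ℝ × M in 𝓝 (0, m₀), b.chart z.2 ∈ Metric.ball (b.chart m₀) (η / 2) :=
    (continuousAt_snd (p := ((0 : ℝ), m₀))).eventually ((b.chart.continuousAt hb.1).eventually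
      (Metric.ball_mem_nhds _ (half_pos hη)))
  have e3 : ∀ᶠ z : ℝ × M in 𝓝 (0, m₀), b'.chart z.2 ∈ Metric.ball (b'.chart m₀) r :=
    (continuousAt_snd (p := ((0 : ℝ), m₀))).eventually ((b'.chart.continuousAt hb'.1).eventually
      (Metric.ball_mem_nhds _ hr0))
  filter_upwards [e1, e2, e3] with z h1 h2 h3 hz
  refine ⟨Metric.ball (b'.chart m₀) r, convex_ball _ _, fun w hw => ?_,
    fun w hw => (hKρ (Metric.ball_subset_ball (min_le_left _ _) hw)).1,
    fun w hw => (hKρ (Metric.ball_subset_ball (min_le_left _ _) hw)).2, fun w hw => hNη ?_⟩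
  · rw [Metric.mem_ball] at *
    have := dist_triangle_right w (b'.chart z.2) (b'.chart m₀)
    have := min_le_right ρ (b'.radius / 2)
    linarith
  · rw [Metric.mem_ball] at *
    have := dist_triangle w (b.chart z.2) (b.chart m₀)
    linarith

end Box

/-- A finite cover of the compact manifold `M` by boxes. Finiteness is only recorded by uniform
constants: `bound` compares, on each box, the metrics with the Euclidean norm of the transverse
coordinates, and points at distance less than `size` of a point of a box can be moved in the
charts of the boxes around it. -/
structure BoxCover (S : ℱ.TransverseSimilarityStructure)
    (k : ContMDiffRiemannianMetric (𝓡 (p + q)) ∞ (Euc (p + q))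
      (fun x : M => TangentSpace (𝓡 (p + q)) x)) where
  boxes : Set (Box S)
  covers : ∀ x, ∃ b ∈ boxes, x ∈ b.inner
  bound : ℝ
  one_le_bound : 1 ≤ bound
  form_comparable : ∀ b ∈ boxes, ∀ x ∈ b.outer, ∀ w : Euc (p + q),
      b.metric.form x w w ≤ bound * ‖transDeriv b.chart x w‖ ^ 2 ∧
      ‖transDeriv b.chart x w‖ ^ 2 ≤ bound * b.metric.form x w w
  inner_comparable : ∀ b ∈ boxes, ∀ x ∈ b.outer, ∀ u : ℱ.normalSpace k x,
      k.inner x u u ≤ bound * ‖transDeriv b.chart x u.1‖ ^ 2 ∧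
      ‖transDeriv b.chart x u.1‖ ^ 2 ≤ bound * k.inner x u u
  size : ℝ
  size_pos : 0 < size
  size_le : ∀ b ∈ boxes, size ≤ b.radius
  isUniform : ∀ b ∈ boxes, ∀ b' ∈ boxes, ∀ m ∈ b.inner ∩ b'.inner, Box.IsUniform b b' size m

theorem nonempty_boxCover [T2Space M] [CompactSpace M] (S : ℱ.TransverseSimilarityStructure)
    (k : ContMDiffRiemannianMetric (𝓡 (p + q)) ∞ (Euc (p + q))
      (fun x : M => TangentSpace (𝓡 (p + q)) x)) : Nonempty (BoxCover S k) := by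
  choose b hb using Box.exists_mem_inner S
  obtain ⟨t, -, ht⟩ := isCompact_univ.elim_nhds_subcover (fun x => (b x).inner)
    (fun x _ => (b x).isOpen_inner.mem_nhds (hb x))
  have hfin : (b '' (t : Set M)).Finite := t.finite_toSet.image b
  obtain ⟨C, hC1, hCf, hCi⟩ := ((eventually_ge_atTop (1 : ℝ)).and
    (((eventually_all_finite hfin).2 fun b _ => b.eventually_form_comparable).and
    ((eventually_all_finite hfin).2 fun b _ => b.eventually_inner_comparable k))).exists
  have hε : ∀ᶠ ε in 𝓝[>] (0 : ℝ), 0 < ε ∧ (∀ b' ∈ b '' t, ε ≤ b'.radius) ∧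
      ∀ b₁ ∈ b '' t, ∀ b₂ ∈ b '' t, ∀ m ∈ b₁.inner ∩ b₂.inner, Box.IsUniform b₁ b₂ ε m := by
    refine eventually_mem_nhdsWithin.and (Eventually.and ?_ ?_)
    · exact (eventually_all_finite hfin).2 fun b' _ =>
        nhdsWithin_le_nhds (ge_mem_nhds b'.radius_pos)
    · exact (eventually_all_finite hfin).2 fun b₁ _ => (eventually_all_finite hfin).2 fun b₂ _ =>
        nhdsWithin_le_nhds (b₁.eventually_isUniform b₂)
  obtain ⟨ε, hε0, hεr, hεu⟩ := hε.exists
  refine ⟨⟨b '' t, fun x => ?_, C, hC1, hCf, hCi, ε, hε0, hεr, hεu⟩⟩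
  obtain ⟨y, hy, hxy⟩ := mem_iUnion₂.1 (ht (mem_univ x))
  exact ⟨b y, mem_image_of_mem b hy, hxy⟩

end Foliation

/-! ### Sliding a transversal ball along a leaf path -/

namespace Foliation

variable {p q : ℕ} {M : Type*} [TopologicalSpace M] [ChartedSpace (Euc (p + q)) M]
  {ℱ : Foliation p q M}

theorem contDiffOn_transition {φ ψ : OpenPartialHomeomorph M (Euc p × Euc q)} (hφ : φ ∈ ℱ.charts)
    (hψ : ψ ∈ ℱ.charts) :
    ContDiffOn ℝ ∞ (fun z => ψ (φ.symm z)) (φ.target ∩ φ.symm ⁻¹' ψ.source) := by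
  rw [← contMDiffOn_iff_contDiffOn]
  exact (ℱ.contMDiffOn ψ hψ).comp ((ℱ.contMDiffOn_symm φ hφ).mono inter_subset_left)
    (fun z hz => hz.2)

/-- Two points of a convex subset of the target of `φ`, whose inverse image lies in the domain of
another chart `ψ`, are in the same plaque of `ψ` if they are in the same plaque of `φ`. -/
theorem snd_eq_of_convex {φ ψ : OpenPartialHomeomorph M (Euc p × Euc q)} (hφ : φ ∈ ℱ.charts)
    (hψ : ψ ∈ ℱ.charts) {K : Set (Euc p × Euc q)} (hK : Convex ℝ K) (hKt : K ⊆ φ.target)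
    (hKs : ∀ z ∈ K, φ.symm z ∈ ψ.source) {z z' : Euc p × Euc q} (hz : z ∈ K) (hz' : z' ∈ K)
    (h : z.2 = z'.2) : (ψ (φ.symm z)).2 = (ψ (φ.symm z')).2 := by
  have hmem : ∀ s : I, AffineMap.lineMap z z' (s : ℝ) ∈ K := fun s =>
    hK.segment_subset hz hz' (segment_eq_image_lineMap ℝ z z' ▸ mem_image_of_mem _ s.2)
  have hcont : Continuous fun s : I => φ.symm (AffineMap.lineMap z z' (s : ℝ)) :=
    φ.continuousOn_symm.comp_continuous
      ((AffineMap.lineMap_continuous).comp continuous_subtype_val) (fun s => hKt (hmem s))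
  have hl : ℱ.IsLeafPath fun s : I => φ.symm (AffineMap.lineMap z z' (s : ℝ)) := by
    refine isLeafPath_of_plaque hφ hcont (fun s => φ.map_target (hKt (hmem s))) fun s t => ?_
    rw [φ.right_inv (hKt (hmem s)), φ.right_inv (hKt (hmem t))]
    simp [AffineMap.lineMap_apply, h]
  simpa using hl.eq_of_subset hψ isPreconnected_univ (fun s _ => hKs _ (hmem s))
    (mem_univ 0) (mem_univ 1)

variable [IsManifold (𝓡 (p + q)) ∞ M] {S : ℱ.TransverseSimilarityStructure}
  {k : ContMDiffRiemannianMetric (𝓡 (p + q)) ∞ (Euc (p + q))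
      (fun x : M => TangentSpace (𝓡 (p + q)) x)}

/-- In a box, a continuous family of points close to `c t` can be slid in their plaques along the
leaf path `c`, during the interval `[t, t']`; the difference of the leaf coordinates is contracted
to `0` on the way, so that the family ends on the vertical transversal through `c t'`. -/
theorem Box.exists_plaque_family (b : Box S) {c : I → M} (hc : ℱ.IsLeafPath c) {t t' : I}
    (htt : t < t') (hcb : ∀ s ∈ Icc t t', c s ∈ b.inner) {D : Set (Euc q)} {m : Euc q → M}
    (hm : ContinuousOn m D) (hms : ∀ v ∈ D, m v ∈ b.chart.source)
    (hmb : ∀ v ∈ D, b.chart (m v) ∈ Metric.ball (b.chart (c t)) b.radius) :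
    ∃ P : Euc q → I → M, ContinuousOn (fun z : Euc q × I => P z.1 z.2) (D ×ˢ univ) ∧
      (∀ v ∈ D, ℱ.IsLeafPath (P v)) ∧ (∀ v ∈ D, P v t = m v) ∧
      (∀ v ∈ D, ∀ s, t' ≤ s → P v s = b.chart.symm ((b.chart (c t')).1, (b.chart (m v)).2)) ∧
      ∀ v ∈ D, m v = c t → ∀ s, t ≤ s → P v s = c (min s t') := by
  set θ : I → I := fun s => max t (min s t') with hθ
  have hθc : Continuous θ := by fun_prop
  have hθm : ∀ s, θ s ∈ Icc t t' := fun s => ⟨le_max_left _ _, max_le htt.le (min_le_right _ _)⟩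
  have htt' : (0 : ℝ) < (t' : ℝ) - t := sub_pos.2 htt
  set l : I → ℝ := fun s => ((θ s : ℝ) - t) / (t' - t) with hl
  have hlc : Continuous l := by fun_prop
  have hl0 : ∀ s, 0 ≤ l s := fun s => div_nonneg (sub_nonneg.2 (hθm s).1) htt'.le
  have hl1 : ∀ s, l s ≤ 1 := fun s =>
    (div_le_one htt').2 (sub_le_sub_right (Subtype.coe_le_coe.2 (hθm s).2) _)
  set Z : Euc q → I → Euc p × Euc q := fun v s => ((b.chart (c (θ s))).1 +
    (1 - l s) • ((b.chart (m v)).1 - (b.chart (c t)).1), (b.chart (m v)).2) with hZ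
  have hZm : ∀ v ∈ D, ∀ s, Z v s ∈ b.chart.target := by
    intro v hv s
    apply b.subset_target
    have h1 := (hcb _ (hθm s)).2
    have h2 := hmb v hv
    have h3 := (hcb t ⟨le_rfl, htt.le⟩).2
    rw [mem_preimage, Metric.mem_ball, Prod.dist_eq, max_lt_iff] at h1 h3
    rw [Metric.mem_ball, Prod.dist_eq, max_lt_iff] at h2
    rw [Metric.mem_closedBall, Prod.dist_eq, max_le_iff]
    constructor
    · have h4 : ‖(1 - l s) • ((b.chart (m v)).1 - (b.chart (c t)).1)‖ ≤ b.radius := by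
        rw [norm_smul, Real.norm_of_nonneg (by linarith [hl1 s]), ← dist_eq_norm]
        have := h2.1
        have h5 : (0 : ℝ) ≤ dist (b.chart (m v)).1 (b.chart (c t)).1 := dist_nonneg
        nlinarith [hl0 s, hl1 s]
      have h5 := h1.1
      rw [dist_eq_norm] at h5 ⊢
      have h6 := norm_add_le ((b.chart (c (θ s))).1 - b.center.1)
        ((1 - l s) • ((b.chart (m v)).1 - (b.chart (c t)).1))
      have h7 : (Z v s).1 - b.center.1 = ((b.chart (c (θ s))).1 - b.center.1) +
        (1 - l s) • ((b.chart (m v)).1 - (b.chart (c t)).1) := by simp only [hZ]; abel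
      rw [h7]
      linarith
    · have := dist_triangle (b.chart (m v)).2 (b.chart (c t)).2 b.center.2
      have := h2.2
      have := h3.2
      simp only [hZ]
      linarith
  have hbc : Continuous fun s => b.chart (c (θ s)) :=
    b.chart.continuousOn.comp_continuous (hc.1.comp hθc) fun s => (hcb _ (hθm s)).1
  have hbm : ContinuousOn (fun v => b.chart (m v)) D := b.chart.continuousOn.comp hm hms
  have hZc : ContinuousOn (fun z : Euc q × I => Z z.1 z.2) (D ×ˢ univ) := by
    have h1 : ContinuousOn (fun z : Euc q × I => b.chart (m z.1)) (D ×ˢ univ) :=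
      hbm.comp continuousOn_fst fun z hz => hz.1
    have h2 : ContinuousOn (fun z : Euc q × I => b.chart (c (θ z.2))) (D ×ˢ univ) :=
      (hbc.comp continuous_snd).continuousOn
    have h3 : ContinuousOn (fun z : Euc q × I => l z.2) (D ×ˢ univ) :=
      (hlc.comp continuous_snd).continuousOn
    exact (h2.fst.add ((continuousOn_const.sub h3).smul (h1.fst.sub continuousOn_const))).prodMk
      h1.snd
  have hPc : ContinuousOn (fun z : Euc q × I => b.chart.symm (Z z.1 z.2)) (D ×ˢ univ) :=
    b.chart.continuousOn_symm.comp hZc fun z hz => hZm z.1 hz.1 z.2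
  refine ⟨fun v s => b.chart.symm (Z v s), hPc, fun v hv => ?_, fun v hv => ?_,
    fun v hv s hs => ?_, fun v hv hvc s hs => ?_⟩
  · refine isLeafPath_of_plaque b.chart_mem (hPc.comp_continuous (f := fun s : I => (v, s))
      (by fun_prop) (fun s => ⟨hv, mem_univ _⟩)) (fun s => b.chart.map_target (hZm v hv s))
      (fun s s' => ?_)
    rw [b.chart.right_inv (hZm v hv s), b.chart.right_inv (hZm v hv s')]
  · have h1 : θ t = t := by simp [hθ, htt.le]
    have h2 : Z v t = b.chart (m v) := by simp [hZ, hl, h1]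
    simp only [h2]
    exact b.chart.left_inv (hms v hv)
  · have h1 : θ s = t' := by simp [hθ, htt.le, hs]
    have h2 : l s = 1 := by simp only [hl, h1]; exact div_self htt'.ne'
    simp [hZ, h1, h2]
  · have h1 : θ s = min s t' := by simp only [hθ]; exact max_eq_right (le_min hs htt.le)
    have h2 : (b.chart (c t)).2 = (b.chart (c (θ s))).2 :=
      hc.eq_of_subset b.chart_mem (J := Icc t t') isPreconnected_Icc (fun r hr => (hcb r hr).1)
        ⟨le_rfl, htt.le⟩ (hθm s)
    have h3 : Z v s = b.chart (c (θ s)) := by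
      simp only [hZ, hvc, h2, sub_self, smul_zero, add_zero]
    simp only [h3, ← h1]
    exact b.chart.left_inv (hcb _ (hθm s)).1

/-- `F` is the holonomy along the leaf path `c` up to time `t`, from the ball of radius `r` in the
vertical transversal of the box `b` through `c 0` to the vertical transversal of the box `b'`
through `c t`, obtained by sliding along the paths `H v`, which stop at time `t`. -/
structure IsSlide (c : I → M) (b b' : Box S) (r : ℝ) (t : I) (F : Euc q → Euc q)
    (H : Euc q → I → M) : Prop where
  mem : c 0 ∈ b.inner
  mem' : c t ∈ b'.inner
  pos : 0 < r
  le : r ≤ b.radius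
  mapsTo : ∀ v ∈ Metric.ball (b.chart (c 0)).2 r, F v ∈ Metric.ball b'.center.2 (2 * b'.radius)
  contDiffOn : ContDiffOn ℝ ∞ F (Metric.ball (b.chart (c 0)).2 r)
  injOn : InjOn F (Metric.ball (b.chart (c 0)).2 r)
  continuousOn : ContinuousOn (fun z : Euc q × I => H z.1 z.2)
    (Metric.ball (b.chart (c 0)).2 r ×ˢ univ)
  leafPath : ∀ v ∈ Metric.ball (b.chart (c 0)).2 r, ℱ.IsLeafPath (H v)
  source : ∀ v ∈ Metric.ball (b.chart (c 0)).2 r, H v 0 = b.chart.symm ((b.chart (c 0)).1, v)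
  target : ∀ v ∈ Metric.ball (b.chart (c 0)).2 r, H v 1 = b'.chart.symm ((b'.chart (c t)).1, F v)
  stationary : ∀ v ∈ Metric.ball (b.chart (c 0)).2 r, ∀ s, t ≤ s → H v s = H v 1
  central : ∀ s, H (b.chart (c 0)).2 s = c (min s t)

theorem Box.mk_mem_ball (b : Box S) {x : M} (hx : x ∈ b.inner) {v : Euc q}
    (hv : v ∈ Metric.ball b.center.2 (2 * b.radius)) :
    ((b.chart x).1, v) ∈ Metric.ball b.center (2 * b.radius) := by
  have h1 := hx.2
  rw [mem_preimage, Metric.mem_ball, Prod.dist_eq, max_lt_iff] at h1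
  rw [Metric.mem_ball, Prod.dist_eq, max_lt_iff]
  exact ⟨h1.1.trans (by linarith [b.radius_pos]), hv⟩

theorem Box.mk_mem_target (b : Box S) {x : M} (hx : x ∈ b.inner) {v : Euc q}
    (hv : v ∈ Metric.ball b.center.2 (2 * b.radius)) :
    ((b.chart x).1, v) ∈ b.chart.target :=
  b.subset_target (Metric.ball_subset_closedBall (b.mk_mem_ball hx hv))

theorem Box.ball_subset (b : Box S) {x : M} (hx : x ∈ b.inner) {r : ℝ} (hr : r ≤ b.radius) :
    Metric.ball (b.chart x).2 r ⊆ Metric.ball b.center.2 (2 * b.radius) := by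
  have h1 := hx.2
  rw [mem_preimage, Metric.mem_ball, Prod.dist_eq, max_lt_iff] at h1
  exact Metric.ball_subset_ball' (by linarith [h1.2])

namespace IsSlide

variable {c : I → M} {b b' b'' : Box S} {r : ℝ} {t t' : I} {F : Euc q → Euc q} {H : Euc q → I → M}

theorem center_mem (h : IsSlide c b b' r t F H) :
    (b.chart (c 0)).2 ∈ Metric.ball (b.chart (c 0)).2 r :=
  Metric.mem_ball_self h.pos

theorem mk_mem_target (h : IsSlide c b b' r t F H) {v : Euc q}
    (hv : v ∈ Metric.ball (b.chart (c 0)).2 r) : ((b.chart (c 0)).1, v) ∈ b.chart.target :=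
  b.mk_mem_target h.mem (b.ball_subset h.mem h.le hv)

theorem mk_mem_target' (h : IsSlide c b b' r t F H) {v : Euc q}
    (hv : v ∈ Metric.ball (b.chart (c 0)).2 r) : ((b'.chart (c t)).1, F v) ∈ b'.chart.target :=
  b'.mk_mem_target h.mem' (h.mapsTo v hv)

theorem apply_center (h : IsSlide c b b' r t F H) :
    F (b.chart (c 0)).2 = (b'.chart (c t)).2 := by
  have h1 := h.target _ h.center_mem
  rw [h.central, min_eq_right unitInterval.le_one'] at h1
  rw [h1, b'.chart.right_inv (h.mk_mem_target' h.center_mem)]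

theorem mono (h : IsSlide c b b' r t F H) {r' : ℝ} (h0 : 0 < r') (hr : r' ≤ r) :
    IsSlide c b b' r' t F H := by
  have hs := Metric.ball_subset_ball (x := (b.chart (c 0)).2) hr
  exact ⟨h.mem, h.mem', h0, hr.trans h.le, fun v hv => h.mapsTo v (hs hv), h.contDiffOn.mono hs,
    h.injOn.mono hs, h.continuousOn.mono (prod_mono_left hs), fun v hv => h.leafPath v (hs hv),
    fun v hv => h.source v (hs hv), fun v hv => h.target v (hs hv),
    fun v hv => h.stationary v (hs hv), h.central⟩

/-- At time `0`, nothing moves. -/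
theorem zero (hc : c 0 ∈ b.inner) (h0 : 0 < r) (hr : r ≤ b.radius) :
    IsSlide c b b r 0 id (fun v _ => b.chart.symm ((b.chart (c 0)).1, v)) := by
  have hm : ∀ v ∈ Metric.ball (b.chart (c 0)).2 r, ((b.chart (c 0)).1, v) ∈ b.chart.target :=
    fun v hv => b.mk_mem_target hc (b.ball_subset hc hr hv)
  refine ⟨hc, hc, h0, hr, fun v hv => b.ball_subset hc hr hv, contDiffOn_id, injOn_id _, ?_,
    fun v hv => ?_, fun _ _ => rfl, fun _ _ => rfl, fun _ _ _ _ => rfl, fun s => ?_⟩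
  · exact b.chart.continuousOn_symm.comp (by fun_prop) (fun z hz => hm z.1 hz.1)
  · exact isLeafPath_of_plaque b.chart_mem continuous_const (fun _ => b.chart.map_target (hm v hv))
      (fun _ _ => rfl)
  · rw [min_eq_right unitInterval.nonneg']
    exact b.chart.left_inv hc.1

/-- A slide up to time `t` whose transversal ball has stayed small can be continued as long as the
central path stays in a box. -/
theorem extend {B : BoxCover S k} (hc : ℱ.IsLeafPath c) (h : IsSlide c b b' r t F H)
    (hb' : b' ∈ B.boxes) (hb'' : b'' ∈ B.boxes) (htt : t < t')
    (hcb : ∀ s ∈ Icc t t', c s ∈ b''.inner)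
    (hF : ∀ v ∈ Metric.ball (b.chart (c 0)).2 r, dist (F v) (b'.chart (c t)).2 < B.size) :
    ∃ F' H', IsSlide c b b'' r t' F' H' := by
  set D := Metric.ball (b.chart (c 0)).2 r with hD
  obtain ⟨K, hK, hKr, hKt, hKs, hKm⟩ := B.isUniform b' hb' b'' hb'' (c t)
    ⟨h.mem', hcb t ⟨le_rfl, htt.le⟩⟩
  have hz : ∀ v ∈ D, ((b'.chart (c t)).1, F v) ∈ Metric.ball (b'.chart (c t)) B.size := by
    intro v hv
    rw [Metric.mem_ball, Prod.dist_eq, max_lt_iff]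
    exact ⟨by simpa using B.size_pos, hF v hv⟩
  set m : Euc q → M := fun v => b'.chart.symm ((b'.chart (c t)).1, F v) with hm
  have hzc : ContinuousOn (fun v => ((b'.chart (c t)).1, F v)) D :=
    continuousOn_const.prodMk h.contDiffOn.continuousOn
  have hmc : ContinuousOn m D :=
    b'.chart.continuousOn_symm.comp hzc fun v hv => (hKm _ (hz v hv)).1
  have hmK : ∀ v ∈ D, b''.chart (m v) ∈ K := fun v hv => (hKm _ (hz v hv)).2.2
  have hms : ∀ v ∈ D, m v ∈ b''.chart.source := fun v hv => (hKm _ (hz v hv)).2.1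
  have hm0 : m (b.chart (c 0)).2 = c t := by
    simp only [hm, h.apply_center]
    exact b'.chart.left_inv h.mem'.1
  obtain ⟨P, hPc, hPl, hPt, hPe, hPm⟩ := b''.exists_plaque_family hc htt hcb hmc hms
    (fun v hv => hKr (hmK v hv))
  have hglue : ∀ v ∈ D, H v t = P v t := fun v hv => by
    rw [h.stationary v hv t le_rfl, h.target v hv, hPt v hv]
  refine ⟨fun v => (b''.chart (m v)).2, fun v s => if s ≤ t then H v s else P v s, h.mem,
    hcb t' ⟨htt.le, le_rfl⟩, h.pos, h.le, fun v hv => ?_, ?_, ?_, ?_, fun v hv => ?_,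
    fun v hv => ?_, fun v hv => ?_, fun v hv s hs => ?_, fun s => ?_⟩
  · have h1 := hKr (hmK v hv)
    have h2 := b''.ball_subset (hcb t ⟨le_rfl, htt.le⟩) le_rfl
    rw [Metric.mem_ball, Prod.dist_eq, max_lt_iff] at h1
    exact h2 h1.2
  · exact contDiff_snd.comp_contDiffOn ((contDiffOn_transition b'.chart_mem b''.chart_mem).comp
      (contDiffOn_const.prodMk h.contDiffOn) fun v hv =>
        ⟨(hKm _ (hz v hv)).1, (hKm _ (hz v hv)).2.1⟩)
  -- injectivity: points in the same plaque of `b''` are joined inside the convex set `K`, hence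
  -- are in the same plaque of `b'`
  · intro v hv v' hv' hvv'
    have h1 := snd_eq_of_convex b''.chart_mem b'.chart_mem hK hKt hKs (hmK v hv) (hmK v' hv') hvv'
    rw [b''.chart.left_inv (hms v hv), b''.chart.left_inv (hms v' hv')] at h1
    simp only [hm] at h1
    rw [b'.chart.right_inv (hKm _ (hz v hv)).1, b'.chart.right_inv (hKm _ (hz v' hv')).1] at h1
    exact h.injOn hv hv' h1
  · rw [continuousOn_iff_continuous_domRestrict] at hPc ⊢
    have hHc := continuousOn_iff_continuous_domRestrict.1 h.continuousOn
    refine Continuous.if_le hHc hPc (continuous_snd.comp continuous_subtype_val)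
      continuous_const ?_
    rintro ⟨⟨v, s⟩, hv, -⟩ (rfl : s = t)
    exact hglue v hv
  · exact (h.leafPath v hv).glue (hPl v hv) t (hglue v hv)
  · rw [if_pos unitInterval.nonneg', h.source v hv]
  · rw [if_neg (htt.trans_le unitInterval.le_one').not_ge, hPe v hv 1 unitInterval.le_one']
  · rw [if_neg (htt.trans_le hs).not_ge, if_neg (htt.trans_le unitInterval.le_one').not_ge,
      hPe v hv s hs, hPe v hv 1 unitInterval.le_one']
  · split_ifs with hst
    · rw [h.central, min_eq_left hst, min_eq_left (hst.trans htt.le)]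
    · exact hPm _ h.center_mem hm0 s (not_le.1 hst).le

end IsSlide

namespace BoxCover

variable (B : BoxCover S k) {c : I → M} {b : Box S} {r : ℝ}

/-- Subdivision of a path by the boxes of a cover. -/
theorem exists_subdivision (hc : Continuous c) :
    ∃ t : ℕ → I, t 0 = 0 ∧ Monotone t ∧ (∃ n, t n = 1) ∧
      ∀ n, ∃ b ∈ B.boxes, ∀ s ∈ Icc (t n) (t (n + 1)), c s ∈ b.inner := by
  obtain ⟨t, h0, hm, ⟨n, hn⟩, h⟩ := exists_monotone_Icc_subset_open_cover_unitInterval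
    (c := fun b : B.boxes => c ⁻¹' b.1.inner) (fun b => b.1.isOpen_inner.preimage hc) (fun s _ => by
      obtain ⟨b, hb, hs⟩ := B.covers (c s)
      exact mem_iUnion.2 ⟨⟨b, hb⟩, hs⟩)
  exact ⟨t, h0, hm, ⟨n, hn n le_rfl⟩, fun n =>
    let ⟨b, hb⟩ := h n; ⟨b.1, b.2, fun s hs => hb hs⟩⟩

/-- If the holonomy along the initial segments of `c` is uniformly Lipschitz, the slides along `c`
can be continued, without shrinking the transversal ball, until the end of `c`. -/
theorem exists_isSlide_of_bound (hc : ℱ.IsLeafPath c) (hb : b ∈ B.boxes) (hcb : c 0 ∈ b.inner)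
    (hr : 0 < r) {K : ℝ} (hK : 1 ≤ K) (hKr : K * r ≤ B.size)
    (hbd : ∀ b' ∈ B.boxes, ∀ t F H, IsSlide c b b' r t F H →
      ∀ v ∈ Metric.ball (b.chart (c 0)).2 r, ‖fderiv ℝ F v‖ ≤ K) :
    ∃ b' ∈ B.boxes, ∃ F H, IsSlide c b b' r 1 F H := by
  obtain ⟨t, h0, hm, ⟨N, hN⟩, hsub⟩ := B.exists_subdivision hc.1
  rw [← hN]
  generalize N = n
  induction n with
  | zero =>
    rw [h0]
    exact ⟨b, hb, _, _, IsSlide.zero hcb hr (by nlinarith [B.size_le b hb])⟩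
  | succ n ih =>
    obtain ⟨b', hb', F, H, h⟩ := ih
    rcases (hm n.le_succ).eq_or_lt with heq | hlt
    · exact ⟨b', hb', F, H, heq ▸ h⟩
    obtain ⟨b'', hb'', hs⟩ := hsub n
    obtain ⟨F', H', h'⟩ := h.extend hc hb' hb'' hlt hs fun v hv => by
      have h1 := (convex_ball (b.chart (c 0)).2 r).norm_image_sub_le_of_norm_fderiv_le
        (fun w hw => (h.contDiffOn.contDiffAt (Metric.isOpen_ball.mem_nhds hw)).differentiableAt
          (by simp)) (hbd b' hb' _ F H h) h.center_mem hv
      rw [h.apply_center, ← dist_eq_norm, ← dist_eq_norm] at h1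
      have h2 := Metric.mem_ball.1 hv
      nlinarith
    exact ⟨b'', hb'', F', H', h'⟩

/-- Along any leaf path there is a slide, on a ball whose radius depends on the path. -/
theorem exists_isSlide (hc : ℱ.IsLeafPath c) (hb : b ∈ B.boxes) (hcb : c 0 ∈ b.inner) :
    ∃ b' ∈ B.boxes, ∃ r F H, IsSlide c b b' r 1 F H := by
  obtain ⟨t, h0, hm, ⟨N, hN⟩, hsub⟩ := B.exists_subdivision hc.1
  rw [← hN]
  generalize N = n
  induction n with
  | zero =>
    rw [h0]
    exact ⟨b, hb, _, _, _, IsSlide.zero hcb b.radius_pos le_rfl⟩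
  | succ n ih =>
    obtain ⟨b', hb', r, F, H, h⟩ := ih
    rcases (hm n.le_succ).eq_or_lt with heq | hlt
    · exact ⟨b', hb', r, F, H, heq ▸ h⟩
    obtain ⟨b'', hb'', hs⟩ := hsub n
    have hF := (h.contDiffOn.continuousOn.continuousAt
      (Metric.isOpen_ball.mem_nhds h.center_mem)).eventually (Metric.ball_mem_nhds _ B.size_pos)
    obtain ⟨r', hr', hrF⟩ := Metric.nhds_basis_ball.eventually_iff.1 hF
    have hh := h.mono (lt_min hr' h.pos) (min_le_right r' r)
    obtain ⟨F', H', h'⟩ := hh.extend hc hb' hb'' hlt hs fun v hv => by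
      have := hrF (Metric.ball_subset_ball (min_le_left _ _) hv)
      rwa [h.apply_center] at this
    exact ⟨b'', hb'', _, F', H', h'⟩

end BoxCover

end Foliation

/-! ### Points of bounded distortion -/

namespace Foliation

variable {p q : ℕ} {M : Type*} [TopologicalSpace M] [ChartedSpace (Euc (p + q)) M]
  {ℱ : Foliation p q M}

theorem IsParallel.congr {c : I → M} {w w' : I → Euc (p + q)} (hw : ℱ.IsParallel c w)
    (h : ∀ t, ∀ φ ∈ ℱ.charts, c t ∈ φ.source → transDeriv φ (c t) (w' t) = transDeriv φ (c t) (w t))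
    (hc : Continuous c) : ℱ.IsParallel c w' := fun φ hφ t ht => by
  filter_upwards [hw φ hφ t ht, hc.continuousAt.eventually (φ.open_source.mem_nhds ht)]
    with s hs hs'
  rw [h s φ hφ hs', h t φ hφ ht, hs]

/-- Concatenation of leaf paths carrying parallel fields. -/
theorem exists_concat {c c' : I → M} {w w' : I → Euc (p + q)} (hc : ℱ.IsLeafPath c)
    (hc' : ℱ.IsLeafPath c') (hw : ℱ.IsParallel c w) (hw' : ℱ.IsParallel c' w') (h : c 1 = c' 0)
    (h' : w 1 = w' 0) : ∃ (d : I → M) (u : I → Euc (p + q)), ℱ.IsLeafPath d ∧ ℱ.IsParallel d u ∧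
      d 0 = c 0 ∧ u 0 = w 0 ∧ d 1 = c' 1 ∧ u 1 = w' 1 := by
  let θ₁ : I → I := fun s => projIcc 0 1 zero_le_one (2 * (s : ℝ))
  let θ₂ : I → I := fun s => projIcc 0 1 zero_le_one (2 * (s : ℝ) - 1)
  have h1 : Continuous θ₁ := continuous_projIcc.comp (by fun_prop)
  have h2 : Continuous θ₂ := continuous_projIcc.comp (by fun_prop)
  let t₀ : I := ⟨1 / 2, by norm_num, by norm_num⟩
  have e1 : θ₁ t₀ = 1 := projIcc_of_right_le _ (by norm_num [t₀])
  have e2 : θ₂ t₀ = 0 := projIcc_of_le_left _ (by norm_num [t₀])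
  have e3 : θ₁ 0 = 0 := projIcc_of_le_left _ (by norm_num)
  have e4 : θ₂ 1 = 1 := projIcc_of_right_le _ (by norm_num)
  have hle : ¬ (1 : I) ≤ t₀ := by
    rw [← Subtype.coe_le_coe]; norm_num [t₀]
  have hle' : (0 : I) ≤ t₀ := unitInterval.nonneg'
  refine ⟨_, _, (hc.comp h1).glue (hc'.comp h2) t₀ (by simp [e1, e2, h]),
    (hw.comp h1).glue (hw'.comp h2) t₀ (by simp [e1, e2, h]) (by simp [e1, e2, h']), ?_, ?_, ?_, ?_⟩
  · simp only [if_pos hle', Function.comp, e3]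
  · simp only [if_pos hle', Function.comp, e3]
  · simp only [if_neg hle, Function.comp, e4]
  · simp only [if_neg hle, Function.comp, e4]

variable [IsManifold (𝓡 (p + q)) ∞ M] {S : ℱ.TransverseSimilarityStructure}
  {k : ContMDiffRiemannianMetric (𝓡 (p + q)) ∞ (Euc (p + q))
      (fun x : M => TangentSpace (𝓡 (p + q)) x)}

namespace IsSlide

variable {c : I → M} {b b' : Box S} {r : ℝ} {t : I} {F : Euc q → Euc q} {H : Euc q → I → M}

/-- The transversal on which a slide starts. -/
noncomputable def startTransversal (h : IsSlide c b b' r t F H) : ℱ.Transversal :=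
  vertical b.chart_mem (b.chart (c 0)).1 (Metric.ball (b.chart (c 0)).2 r) Metric.isOpen_ball
    fun _ hv => h.mk_mem_target hv

/-- The transversal on which a slide ends. -/
noncomputable def endTransversal (h : IsSlide c b b' r t F H) : ℱ.Transversal :=
  vertical b'.chart_mem (b'.chart (c t)).1 (Metric.ball b'.center.2 (2 * b'.radius))
    Metric.isOpen_ball fun _ hv => b'.mk_mem_target h.mem' hv

theorem isHolonomyMap (h : IsSlide c b b' r t F H) :
    ℱ.IsHolonomyMap h.startTransversal h.endTransversal F H :=
  ⟨h.mapsTo, h.contDiffOn, h.injOn, h.continuousOn, h.leafPath, h.source, h.target⟩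

theorem mem_outer (h : IsSlide c b b' r t F H) {v : Euc q}
    (hv : v ∈ Metric.ball (b.chart (c 0)).2 r) : H v 0 ∈ b.outer := by
  rw [h.source v hv]
  exact b.symm_mem_outer (Metric.ball_subset_closedBall
    (b.mk_mem_ball h.mem (b.ball_subset h.mem h.le hv)))

theorem mem_outer' (h : IsSlide c b b' r t F H) {v : Euc q}
    (hv : v ∈ Metric.ball (b.chart (c 0)).2 r) : H v 1 ∈ b'.outer := by
  rw [h.target v hv]
  exact b'.symm_mem_outer (Metric.ball_subset_closedBall (b'.mk_mem_ball h.mem' (h.mapsTo v hv)))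

/-- The derivative of a slide is the parallel transport along its paths. -/
theorem exists_isParallel (h : IsSlide c b b' r t F H) {v : Euc q}
    (hv : v ∈ Metric.ball (b.chart (c 0)).2 r) (ξ : Euc q) :
    ∃ w : I → Euc (p + q), ℱ.IsParallel (H v) w ∧ transDeriv b.chart (H v 0) (w 0) = ξ ∧
      transDeriv b'.chart (H v 1) (w 1) = fderiv ℝ F v ξ := by
  obtain ⟨w, hw, h0, h1⟩ := h.isHolonomyMap.exists_isParallel hv ξ
  refine ⟨w, hw, ?_, ?_⟩
  · rw [h.source v hv]
    exact (h0 _ b.chart_mem (b.chart.map_target (h.mk_mem_target hv))).trans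
      (transDeriv_vertical b.chart_mem (h.mk_mem_target hv) ξ)
  · rw [h.target v hv]
    exact (h1 _ b'.chart_mem (b'.chart.map_target (h.mk_mem_target' hv))).trans
      (transDeriv_vertical b'.chart_mem (h.mk_mem_target' hv) _)

/-- Parallel fields along the central path are transported by the derivative of the slide. -/
theorem transDeriv_central (h : IsSlide c b b' r t F H) (hc : ℱ.IsLeafPath c)
    {w : I → Euc (p + q)} (hw : ℱ.IsParallel c w) :
    transDeriv b'.chart (c t) (w t) =
      fderiv ℝ F (b.chart (c 0)).2 (transDeriv b.chart (c 0) (w 0)) := by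
  obtain ⟨u, hu, h0, h1⟩ := h.exists_isParallel h.center_mem (transDeriv b.chart (c 0) (w 0))
  have hH : H (b.chart (c 0)).2 = c ∘ fun s => min s t := funext h.central
  have hm : Continuous fun s : I => min s t := by fun_prop
  rw [hH] at hu h0 h1
  have e0 : min 0 t = 0 := min_eq_left unitInterval.nonneg'
  have e1 : min 1 t = t := min_eq_right unitInterval.le_one'
  have := (hw.comp hm).congr_end (hc.comp hm).1 hu (s := 0) (t := 1) b.chart_mem
    (by simpa [e0] using h.mem.1) b'.chart_mem (by simpa [e1] using h.mem'.1)
    (by rw [h0]; simp)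
  rw [h1] at this
  simpa [e1] using this

end IsSlide

namespace BoxCover

variable (B : BoxCover S k) {c : I → M} {b b' : Box S} {r : ℝ} {t : I} {F : Euc q → Euc q}
  {H : Euc q → I → M} {x y : M} {Λ : ℝ}

theorem bound_pos : 0 < B.bound := one_pos.trans_le B.one_le_bound

theorem sqrt_inner_comparable (hb : b ∈ B.boxes) (hx : x ∈ b.outer) (u : ℱ.normalSpace k x) :
    √(k.inner x u u) ≤ B.bound * ‖transDeriv b.chart x u.1‖ ∧
      ‖transDeriv b.chart x u.1‖ ≤ B.bound * √(k.inner x u u) := by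
  obtain ⟨h1, h2⟩ := B.inner_comparable b hb x hx u
  have hC := B.one_le_bound
  have hCC : B.bound ≤ B.bound ^ 2 := by nlinarith
  have h0 : 0 ≤ k.inner x u u := by
    have : 0 ≤ ‖transDeriv b.chart x u.1‖ ^ 2 := by positivity
    exact nonneg_of_mul_nonneg_right (this.trans h2) B.bound_pos
  constructor
  · refine Real.sqrt_le_iff.2 ⟨mul_nonneg B.bound_pos.le (norm_nonneg _), h1.trans ?_⟩
    rw [mul_pow]
    gcongr
  · refine abs_le_of_sq_le_sq' ?_ (mul_nonneg B.bound_pos.le (Real.sqrt_nonneg _)) |>.2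
    rw [mul_pow, Real.sq_sqrt h0]
    exact h2.trans (by gcongr)

theorem norm_transDeriv_le (hb : b ∈ B.boxes) (hb' : b' ∈ B.boxes) (hx : x ∈ b.outer)
    (hx' : x ∈ b'.outer) (w : Euc (p + q)) :
    ‖transDeriv b'.chart x w‖ ≤ B.bound ^ 2 * ‖transDeriv b.chart x w‖ := by
  obtain ⟨u, hu⟩ := exists_normalSpace_transDeriv_eq (k := k) (ℱ := ℱ) (x := x) w
  rw [← hu _ b.chart_mem hx.1, ← hu _ b'.chart_mem hx'.1, pow_two, mul_assoc]
  exact (B.sqrt_inner_comparable hb' hx' u).2.trans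
    (mul_le_mul_of_nonneg_left (B.sqrt_inner_comparable hb hx u).1 B.bound_pos.le)

/-- Holonomy invariance makes slides uniformly quasi-conformal with constant distortion: being a
homothety for the metrics of the similarity structure, a slide expands all tangent vectors of its
transversal ball by the same factor, up to a constant. -/
theorem conformal (hS : S.IsHolonomyInvariant) (hb : b ∈ B.boxes) (hb' : b' ∈ B.boxes)
    (h : IsSlide c b b' r t F H) {v v' : Euc q} (hv : v ∈ Metric.ball (b.chart (c 0)).2 r)
    (hv' : v' ∈ Metric.ball (b.chart (c 0)).2 r) (ξ ξ' : Euc q) :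
    ‖fderiv ℝ F v ξ‖ * ‖ξ'‖ ≤ B.bound ^ 2 * ‖fderiv ℝ F v' ξ'‖ * ‖ξ‖ := by
  obtain ⟨ρ, hρ⟩ := hS b.metric b.metric_mem b'.metric b'.metric_mem h.startTransversal
    h.endTransversal F H (Metric.isConnected_ball h.pos)
    (Metric.isConnected_ball (by linarith [b'.radius_pos]))
    (by
      rintro _ ⟨v, hv, rfl⟩
      exact b.subset_dom _ (Metric.ball_subset_closedBall
        (b.mk_mem_ball h.mem (b.ball_subset h.mem h.le hv))))
    (by
      rintro _ ⟨v, hv, rfl⟩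
      exact b'.subset_dom _ (Metric.ball_subset_closedBall (b'.mk_mem_ball h.mem' hv)))
    h.isHolonomyMap
  -- in the coordinates of the boxes, the two quadratic forms are comparable to the squared norms
  have key : ∀ v ∈ Metric.ball (b.chart (c 0)).2 r, ∀ ξ : Euc q, ∃ g g' : ℝ, 0 ≤ g ∧ g' = ρ * g ∧
      g ≤ B.bound * ‖ξ‖ ^ 2 ∧ ‖ξ‖ ^ 2 ≤ B.bound * g ∧
      g' ≤ B.bound * ‖fderiv ℝ F v ξ‖ ^ 2 ∧ ‖fderiv ℝ F v ξ‖ ^ 2 ≤ B.bound * g' := by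
    intro v hv ξ
    have h1 := B.form_comparable b hb _ (h.source v hv ▸ h.mem_outer hv)
      (paramDeriv (fun v => b.chart.symm ((b.chart (c 0)).1, v)) v ξ)
    rw [transDeriv_vertical b.chart_mem (h.mk_mem_target hv)] at h1
    have h2 := B.form_comparable b' hb' _ (h.target v hv ▸ h.mem_outer' hv)
      (paramDeriv (fun v => b'.chart.symm ((b'.chart (c t)).1, v)) (F v) (fderiv ℝ F v ξ))
    rw [transDeriv_vertical b'.chart_mem (h.mk_mem_target' hv)] at h2
    refine ⟨_, _, ?_, hρ v hv ξ ξ, h1.1, h1.2, h2.1, h2.2⟩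
    exact nonneg_of_mul_nonneg_right ((sq_nonneg ‖ξ‖).trans h1.2) B.bound_pos
  obtain ⟨g, _, hg0, rfl, hg1, -, -, hg4⟩ := key v hv ξ
  obtain ⟨g', _, hg0', rfl, -, hg2', hg3', -⟩ := key v' hv' ξ'
  have hC := B.bound_pos
  rcases le_or_gt ρ 0 with hneg | hpos
  · have h1 : ‖fderiv ℝ F v ξ‖ ^ 2 ≤ 0 :=
      hg4.trans (mul_nonpos_of_nonneg_of_nonpos hC.le (mul_nonpos_of_nonpos_of_nonneg hneg hg0))
    have h2 : ‖fderiv ℝ F v ξ‖ = 0 := by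
      have := sq_nonneg ‖fderiv ℝ F v ξ‖
      exact pow_eq_zero_iff two_ne_zero |>.1 (le_antisymm h1 this)
    rw [h2, zero_mul]
    positivity
  · refine abs_le_of_sq_le_sq' ?_ (by positivity) |>.2
    calc (‖fderiv ℝ F v ξ‖ * ‖ξ'‖) ^ 2 = ‖fderiv ℝ F v ξ‖ ^ 2 * ‖ξ'‖ ^ 2 := by ring
      _ ≤ (B.bound * (ρ * (B.bound * ‖ξ‖ ^ 2))) * (B.bound * g') := by
        gcongr
        exact hg4.trans (by gcongr)
      _ = B.bound ^ 3 * ‖ξ‖ ^ 2 * (ρ * g') := by ring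
      _ ≤ B.bound ^ 3 * ‖ξ‖ ^ 2 * (B.bound * ‖fderiv ℝ F v' ξ'‖ ^ 2) := by gcongr
      _ = _ := by ring

/-- Along a leaf path, a vector at the origin extends to a parallel field. -/
theorem exists_isParallel (B : BoxCover S k) (hc : ℱ.IsLeafPath c) (w₀ : Euc (p + q)) :
    ∃ w : I → Euc (p + q), ℱ.IsParallel c w ∧ w 0 = w₀ := by
  obtain ⟨b, hb, hcb⟩ := B.covers (c 0)
  obtain ⟨b', -, r, F, H, h⟩ := B.exists_isSlide hc hb hcb
  obtain ⟨w, hw, h0, -⟩ := h.exists_isParallel h.center_mem (transDeriv b.chart (c 0) w₀)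
  have hH : H (b.chart (c 0)).2 = c := by
    funext s
    rw [h.central, min_eq_left unitInterval.le_one']
  rw [hH] at hw h0
  refine ⟨Function.update w 0 w₀, hw.congr (fun t φ hφ ht => ?_) hc.1, by simp⟩
  rcases eq_or_ne t 0 with rfl | hne
  · have := transDeriv_eq_zero_of b.chart_mem hφ hcb.1 ht (w := w₀ - w 0)
      (by rw [map_sub, h0, sub_self])
    rw [map_sub, sub_eq_zero] at this
    simpa using this
  · simp [hne]

theorem exists_isParallel_one (B : BoxCover S k) (hc : ℱ.IsLeafPath c) (w₁ : Euc (p + q)) :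
    ∃ w : I → Euc (p + q), ℱ.IsParallel c w ∧ w 1 = w₁ := by
  obtain ⟨w, hw, h⟩ := B.exists_isParallel (hc.comp unitInterval.continuous_symm) w₁
  refine ⟨w ∘ unitInterval.symm, ?_, by simpa using h⟩
  have := hw.comp unitInterval.continuous_symm
  convert this using 1
  funext s
  simp

/-- The parallel transport along the leaf paths from `x` distorts norms, measured in the boxes of
the cover, by a factor at most `Λ`. -/
def IsBounded (Λ : ℝ) (x : M) : Prop :=
  ∀ c : I → M, ℱ.IsLeafPath c → c 0 = x → ∀ w : I → Euc (p + q), ℱ.IsParallel c w →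
    ∀ b ∈ B.boxes, ∀ b' ∈ B.boxes, c 0 ∈ b.outer → c 1 ∈ b'.outer →
      ‖transDeriv b'.chart (c 1) (w 1)‖ ≤ Λ * ‖transDeriv b.chart (c 0) (w 0)‖ ∧
      ‖transDeriv b.chart (c 0) (w 0)‖ ≤ Λ * ‖transDeriv b'.chart (c 1) (w 1)‖

/-- The points from which parallel transport has bounded distortion. -/
def boundedSet : Set M := {x | ∃ Λ, 1 ≤ Λ ∧ B.IsBounded Λ x}

theorem biEquicontinuityDomain_eq : ℱ.biEquicontinuityDomain k = B.boundedSet := by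
  have hC := B.one_le_bound
  have hC0 := B.bound_pos
  ext x
  constructor
  · rintro ⟨δ, hδ, hx⟩
    have hδ0 : 0 < δ := one_pos.trans hδ
    have hCC : 1 ≤ B.bound ^ 2 := one_le_pow₀ hC
    refine ⟨B.bound ^ 2 * δ, by nlinarith, ?_⟩
    rintro c hc rfl w hw b hb b' hb' hcb hcb'
    obtain ⟨b₀, hb₀, hcb₀⟩ := B.covers (c 0)
    obtain ⟨b₁, -, r, F, H, h⟩ := B.exists_isSlide hc hb₀ hcb₀
    have hH : ∀ t, H (b₀.chart (c 0)).2 t = c t := fun t => by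
      rw [h.central, min_eq_left unitInterval.le_one']
    obtain ⟨L, hL⟩ := h.isHolonomyMap.exists_isInfinitesimalHolonomy (k := k) h.center_mem
      b₀.chart_mem (b₀.chart.map_target (h.mk_mem_target h.center_mem))
      (transDeriv_vertical b₀.chart_mem (h.mk_mem_target h.center_mem))
      ((h.source _ h.center_mem).symm.trans (hH 0)) ((h.target _ h.center_mem).symm.trans (hH 1))
      (⟨⟨c, hc.1⟩, rfl, rfl⟩ : Path (c 0) (c 1)) hH
    obtain ⟨u, hu⟩ := exists_normalSpace_transDeriv_eq (k := k) (ℱ := ℱ) (x := c 0) (w 0)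
    obtain ⟨w', hw', h0, h1⟩ := hL.exists_isParallel u
    have e0 := hu _ b.chart_mem hcb.1
    have e1 : transDeriv b'.chart (c 1) (w 1) = transDeriv b'.chart (c 1) (L u).1 :=
      (hw.congr_end hc.1 hw' b.chart_mem hcb.1 b'.chart_mem hcb'.1
        (e0.symm.trans (h0 _ b.chart_mem hcb.1).symm)).trans (h1 _ b'.chart_mem hcb'.1)
    rw [← e0, e1]
    obtain ⟨i1, i2⟩ := hx _ _ hc L hL u
    obtain ⟨j1, j2⟩ := B.sqrt_inner_comparable hb hcb u
    obtain ⟨k1, k2⟩ := B.sqrt_inner_comparable hb' hcb' (L u)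
    rw [div_le_iff₀ hδ0] at i1
    constructor
    · calc _ ≤ B.bound * _ := k2
        _ ≤ B.bound * (δ * (B.bound * ‖transDeriv b.chart (c 0) u.1‖)) := by
          gcongr
          exact i2.trans (by gcongr)
        _ = _ := by ring
    · calc _ ≤ B.bound * _ := j2
        _ ≤ B.bound * ((B.bound * ‖transDeriv b'.chart (c 1) (L u).1‖) * δ) := by
          gcongr
          exact i1.trans (by gcongr)
        _ = _ := by ring
  · rintro ⟨Λ, hΛ, hx⟩
    have hCC : 1 ≤ B.bound ^ 2 := one_le_pow₀ hC
    refine ⟨B.bound ^ 2 * (Λ + 1), by nlinarith, fun y c hc L hL u => ?_⟩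
    obtain ⟨w, hw, h0, h1⟩ := hL.exists_isParallel u
    obtain ⟨b, hb, hxb⟩ := B.covers x
    obtain ⟨b', hb', hyb⟩ := B.covers y
    have hxb := b.inner_subset_outer hxb
    have hyb := b'.inner_subset_outer hyb
    have key := hx c hc c.source w hw b hb b' hb' (by rwa [c.source]) (by rwa [c.target])
    rw [c.source, c.target, h0 _ b.chart_mem hxb.1, h1 _ b'.chart_mem hyb.1] at key
    obtain ⟨i1, i2⟩ := key
    obtain ⟨j1, j2⟩ := B.sqrt_inner_comparable hb hxb u
    obtain ⟨k1, k2⟩ := B.sqrt_inner_comparable hb' hyb (L u)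
    have hΛ' : Λ ≤ Λ + 1 := by linarith
    rw [div_le_iff₀ (by positivity)]
    constructor
    · calc _ ≤ B.bound * _ := j1
        _ ≤ B.bound * ((Λ + 1) * (B.bound * √(k.inner y (L u) (L u)))) := by
          gcongr
          exact i2.trans (by gcongr)
        _ = _ := by ring
    · calc _ ≤ B.bound * _ := k1
        _ ≤ B.bound * ((Λ + 1) * (B.bound * √(k.inner x u u))) := by
          gcongr
          exact i1.trans (by gcongr)
        _ = _ := by ring

/-- Bounded distortion is inherited by the end of a leaf path along which parallel transport has
bounded distortion. -/
theorem IsBounded.transport {B : BoxCover S k} (h : B.IsBounded Λ (c 0)) (hΛ : 0 ≤ Λ)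
    (hc : ℱ.IsLeafPath c) {Δ : ℝ} (hΔ : 0 ≤ Δ) (hb : b ∈ B.boxes) (hb' : b' ∈ B.boxes)
    (hcb : c 0 ∈ b.outer) (hcb' : c 1 ∈ b'.outer)
    (hd : ∀ w : I → Euc (p + q), ℱ.IsParallel c w →
      ‖transDeriv b'.chart (c 1) (w 1)‖ ≤ Δ * ‖transDeriv b.chart (c 0) (w 0)‖ ∧
      ‖transDeriv b.chart (c 0) (w 0)‖ ≤ Δ * ‖transDeriv b'.chart (c 1) (w 1)‖) :
    B.IsBounded (B.bound ^ 2 * Δ * Λ) (c 1) := by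
  intro c' hc' h0 w' hw' b₁ hb₁ b₂ hb₂ hcb₁ hcb₂
  obtain ⟨w, hw, hw1⟩ := B.exists_isParallel_one hc (w' 0)
  obtain ⟨d, u, hd', hu, d0, u0, d1, u1⟩ := exists_concat hc hc' hw hw' h0.symm hw1
  obtain ⟨i1, i2⟩ := h d hd' d0 u hu b hb b₂ hb₂ (by rwa [d0]) (by rwa [d1])
  rw [d0, d1, u0, u1] at i1 i2
  obtain ⟨j1, j2⟩ := hd w hw
  rw [hw1] at j1 j2
  rw [h0] at hcb₁ ⊢
  have k1 := B.norm_transDeriv_le hb' hb₁ hcb' hcb₁ (w' 0)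
  have k2 := B.norm_transDeriv_le hb₁ hb' hcb₁ hcb' (w' 0)
  have hC0 := B.bound_pos
  constructor
  · calc _ ≤ Λ * _ := i1
      _ ≤ Λ * (Δ * (B.bound ^ 2 * ‖transDeriv b₁.chart (c 1) (w' 0)‖)) := by
        gcongr
        exact j2.trans (by gcongr)
      _ = _ := by ring
  · calc _ ≤ B.bound ^ 2 * _ := k1
      _ ≤ B.bound ^ 2 * (Δ * (Λ * ‖transDeriv b₂.chart (c' 1) (w' 1)‖)) := by
        gcongr
        exact j1.trans (by gcongr)
      _ = _ := by ring

/-- The set of points of bounded distortion is saturated by the leaves. -/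
theorem mem_boundedSet_of_leafPath (hc : ℱ.IsLeafPath c) (h : c 0 ∈ B.boundedSet) :
    c 1 ∈ B.boundedSet := by
  obtain ⟨Λ, hΛ, h⟩ := h
  obtain ⟨b, hb, hcb⟩ := B.covers (c 0)
  obtain ⟨b', hb', hcb'⟩ := B.covers (c 1)
  have hcb := b.inner_subset_outer hcb
  have hcb' := b'.inner_subset_outer hcb'
  have hΛ0 : 0 ≤ Λ := zero_le_one.trans hΛ
  refine ⟨_, ?_, h.transport hΛ0 hc hΛ0 hb hb' hcb hcb'
    fun w hw => h c hc rfl w hw b hb b' hb' hcb hcb'⟩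
  exact one_le_mul_of_one_le_of_one_le (one_le_mul_of_one_le_of_one_le
    (one_le_pow₀ B.one_le_bound) hΛ) hΛ

/-- Inside a plaque of a box the loss in the bound does not depend on `Λ`, the transport along the
plaque being the identity in the transverse coordinates. -/
theorem IsBounded.of_plaque {B : BoxCover S k} (h : B.IsBounded Λ x) (hΛ : 0 ≤ Λ)
    (hb : b ∈ B.boxes) (hx : x ∈ b.outer) (hy : y ∈ b.outer)
    (hxy : (b.chart x).2 = (b.chart y).2) : B.IsBounded (B.bound ^ 2 * Λ) y := by
  set Z : I → Euc p × Euc q := fun s => AffineMap.lineMap (b.chart x) (b.chart y) (s : ℝ) with hZ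
  have hZm : ∀ s, Z s ∈ b.chart.target := fun s => b.subset_target <|
    (convex_closedBall b.center (2 * b.radius)).segment_subset hx.2 hy.2
      (segment_eq_image_lineMap ℝ (b.chart x) (b.chart y) ▸ mem_image_of_mem _ s.2)
  have hcont : Continuous fun s => b.chart.symm (Z s) := b.chart.continuousOn_symm.comp_continuous
    (AffineMap.lineMap_continuous.comp continuous_subtype_val) hZm
  have hs : ∀ s, b.chart.symm (Z s) ∈ b.chart.source := fun s => b.chart.map_target (hZm s)
  have hc : ℱ.IsLeafPath fun s => b.chart.symm (Z s) := by
    refine isLeafPath_of_plaque b.chart_mem hcont hs fun s t => ?_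
    rw [b.chart.right_inv (hZm s), b.chart.right_inv (hZm t)]
    simp [hZ, AffineMap.lineMap_apply, hxy]
  have h0 : b.chart.symm (Z 0) = x := by simp [hZ, b.chart.left_inv hx.1]
  have h1 : b.chart.symm (Z 1) = y := by simp [hZ, b.chart.left_inv hy.1]
  have := IsBounded.transport (c := fun s => b.chart.symm (Z s)) (by rwa [h0]) hΛ hc zero_le_one
    hb hb (by rwa [h0]) (by rwa [h1]) fun w hw => by
      rw [hw.eq_of_subset b.chart_mem isPreconnected_univ (fun s _ => hs s) (mem_univ 0)
        (mem_univ 1)]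
      simp
  rwa [h1, mul_one] at this

/-- If one of the points of the transversal ball of a slide has bounded distortion, then the
derivative of the slide is bounded above and below. -/
theorem norm_fderiv_of_isBounded (hS : S.IsHolonomyInvariant) (hb : b ∈ B.boxes)
    (hb' : b' ∈ B.boxes) (h : IsSlide c b b' r t F H) {v : Euc q}
    (hv : v ∈ Metric.ball (b.chart (c 0)).2 r) (hΛ : 0 ≤ Λ) (hy : B.IsBounded Λ (H v 0))
    {v' : Euc q} (hv' : v' ∈ Metric.ball (b.chart (c 0)).2 r) (ξ : Euc q) :
    ‖fderiv ℝ F v' ξ‖ ≤ B.bound ^ 2 * Λ * ‖ξ‖ ∧ ‖ξ‖ ≤ B.bound ^ 2 * Λ * ‖fderiv ℝ F v' ξ‖ := by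
  obtain ⟨w, hw, h0, h1⟩ := h.exists_isParallel hv ξ
  obtain ⟨i1, i2⟩ := hy _ (h.leafPath v hv) rfl w hw b hb b' hb' (h.mem_outer hv) (h.mem_outer' hv)
  rw [h0, h1] at i1 i2
  have hC0 := B.bound_pos
  rcases eq_or_ne ξ 0 with rfl | hξ
  · simp
  have hn : 0 < ‖ξ‖ := norm_pos_iff.2 hξ
  have c1 := le_of_mul_le_mul_right (B.conformal hS hb hb' h hv' hv ξ ξ) hn
  have c2 := le_of_mul_le_mul_right (B.conformal hS hb hb' h hv hv' ξ ξ) hn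
  constructor
  · calc _ ≤ _ := c1
      _ ≤ B.bound ^ 2 * (Λ * ‖ξ‖) := by gcongr
      _ = _ := by ring
  · calc _ ≤ _ := i2
      _ ≤ Λ * (B.bound ^ 2 * ‖fderiv ℝ F v' ξ‖) := by gcongr
      _ = _ := by ring

/-- Bounded distortion at `x` allows sliding all the leaf paths from a point `y` close to `x`,
uniformly: the distortion at `y` is bounded too. -/
theorem isOpen_boundedSet (hS : S.IsHolonomyInvariant) : IsOpen B.boundedSet := by
  rw [isOpen_iff_mem_nhds]
  rintro x ⟨Λ, hΛ, hx⟩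
  have hC := B.one_le_bound
  have hC0 := B.bound_pos
  have hΛ0 : 0 < Λ := one_pos.trans_le hΛ
  obtain ⟨b, hb, hxb⟩ := B.covers x
  set K := B.bound ^ 2 * (B.bound ^ 2 * Λ)
  have hK1 : 1 ≤ K := one_le_mul_of_one_le_of_one_le (one_le_pow₀ hC)
    (one_le_mul_of_one_le_of_one_le (one_le_pow₀ hC) hΛ)
  have hK0 : 0 < K := one_pos.trans_le hK1
  set r := B.size / K
  have hr0 : 0 < r := div_pos B.size_pos hK0
  have hKr : K * r = B.size := mul_div_cancel₀ _ hK0.ne'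
  have hnear : ∀ᶠ y in 𝓝 x, (b.chart x).2 ∈ Metric.ball (b.chart y).2 r := by
    filter_upwards [(b.chart.continuousAt hxb.1).snd.eventually (Metric.ball_mem_nhds _ hr0)]
      with y hy
    rwa [Metric.mem_ball, dist_comm]
  filter_upwards [b.isOpen_inner.mem_nhds hxb, hnear] with y hyb hyx
  refine ⟨B.bound ^ 2 * (K * B.bound ^ 2), one_le_mul_of_one_le_of_one_le (one_le_pow₀ hC)
    (one_le_mul_of_one_le_of_one_le hK1 (one_le_pow₀ hC)), ?_⟩
  rintro c hc rfl w hw b₁ hb₁ b₂ hb₂ hcb₁ hcb₂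
  have hbd : ∀ b' ∈ B.boxes, ∀ t F H, IsSlide c b b' r t F H →
      ∀ v ∈ Metric.ball (b.chart (c 0)).2 r, ∀ ξ, ‖fderiv ℝ F v ξ‖ ≤ K * ‖ξ‖ ∧
        ‖ξ‖ ≤ K * ‖fderiv ℝ F v ξ‖ := by
    intro b' hb' t F H h v hv ξ
    refine B.norm_fderiv_of_isBounded hS hb hb' h hyx (by positivity) ?_ hv ξ
    refine hx.of_plaque hΛ0.le hb (b.inner_subset_outer hxb) (h.mem_outer hyx) ?_
    rw [h.source _ hyx, b.chart.right_inv (h.mk_mem_target hyx)]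
  obtain ⟨b', hb', F, H, h⟩ := B.exists_isSlide_of_bound hc hb hyb hr0 hK1 hKr.le
    fun b' hb' t F H h v hv => ContinuousLinearMap.opNorm_le_bound _ hK0.le
      fun ξ => (hbd b' hb' t F H h v hv ξ).1
  obtain ⟨i1, i2⟩ := hbd b' hb' 1 F H h _ h.center_mem (transDeriv b.chart (c 0) (w 0))
  rw [← h.transDeriv_central hc hw] at i1 i2
  have hyb := b.inner_subset_outer hyb
  have hyb' := b'.inner_subset_outer h.mem'
  constructor
  · calc _ ≤ _ := B.norm_transDeriv_le hb' hb₂ hyb' hcb₂ _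
      _ ≤ B.bound ^ 2 * (K * (B.bound ^ 2 * ‖transDeriv b₁.chart (c 0) (w 0)‖)) := by
        gcongr
        exact i1.trans (by gcongr; exact B.norm_transDeriv_le hb₁ hb hcb₁ hyb _)
      _ = _ := by ring
  · calc _ ≤ _ := B.norm_transDeriv_le hb hb₁ hyb hcb₁ _
      _ ≤ B.bound ^ 2 * (K * (B.bound ^ 2 * ‖transDeriv b₂.chart (c 1) (w 1)‖)) := by
        gcongr
        exact i2.trans (by gcongr; exact B.norm_transDeriv_le hb₂ hb' hcb₂ hyb' _)
      _ = _ := by ring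

/-- The closure of the set of points of bounded distortion is saturated by the leaves. -/
theorem mem_closure_boundedSet_of_leafPath (hc : ℱ.IsLeafPath c) (h : c 0 ∈ closure B.boundedSet) :
    c 1 ∈ closure B.boundedSet := by
  rw [mem_closure_iff_nhds] at h ⊢
  intro U hU
  obtain ⟨b, hb, hcb⟩ := B.covers (c 0)
  obtain ⟨b', hb', r, F, H, hs⟩ := B.exists_isSlide hc hb hcb
  have hball := Metric.isOpen_ball.mem_nhds hs.center_mem
  have hHc : ContinuousAt (fun v => H v 1) (b.chart (c 0)).2 :=
    (hs.continuousOn.continuousAt (prod_mem_nhds hball univ_mem)).comp (f := fun v => (v, (1 : I)))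
      (x := (b.chart (c 0)).2) (continuousAt_id.prodMk continuousAt_const)
  have hH1 : H (b.chart (c 0)).2 1 = c 1 := by rw [hs.central, min_self]
  have hHU : ∀ᶠ v in 𝓝 (b.chart (c 0)).2, H v 1 ∈ U := hHc (show U ∈ 𝓝 (H _ 1) by rwa [hH1])
  have h1 := (b.chart.continuousAt hcb.1).snd.eventually (hHU.and hball)
  obtain ⟨y, ⟨⟨hyU, hyb⟩, hyi⟩, Λ, hΛ, hy⟩ := h _ (h1.and (b.isOpen_inner.mem_nhds hcb))
  refine ⟨_, hyU, B.mem_boundedSet_of_leafPath (hs.leafPath _ hyb) ⟨_, ?_,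
    hy.of_plaque (zero_le_one.trans hΛ) hb (b.inner_subset_outer hyi) (hs.mem_outer hyb) ?_⟩⟩
  · exact one_le_mul_of_one_le_of_one_le (one_le_pow₀ B.one_le_bound) hΛ
  · rw [hs.source _ hyb, b.chart.right_inv (hs.mk_mem_target hyb)]

/-- A contraction slides uniformly. If a parallel field along `c` does not grow, up to a factor `L`,
and `v` is a point of bounded distortion in a transversal ball through `c 0` whose size depends on
`L` only, then the field cannot shrink too much. -/
theorem norm_le_of_isBounded (hS : S.IsHolonomyInvariant) (hc : ℱ.IsLeafPath c)
    {w : I → Euc (p + q)} (hw : ℱ.IsParallel c w) (hb : b ∈ B.boxes) (hcb : c 0 ∈ b.inner)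
    (hw0 : 0 < ‖transDeriv b.chart (c 0) (w 0)‖) {L : ℝ} (hL : 1 ≤ L)
    (hwL : ∀ t, ∀ b' ∈ B.boxes, c t ∈ b'.inner →
      ‖transDeriv b'.chart (c t) (w t)‖ ≤ L * ‖transDeriv b.chart (c 0) (w 0)‖)
    {v : Euc q} (hv : v ∈ Metric.ball (b.chart (c 0)).2 (B.size / (B.bound ^ 2 * L))) (hΛ : 0 ≤ Λ)
    (hy : B.IsBounded Λ (b.chart.symm ((b.chart (c 0)).1, v))) (hb' : b' ∈ B.boxes)
    (hcb' : c 1 ∈ b'.outer) :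
    ‖transDeriv b.chart (c 0) (w 0)‖ ≤ B.bound ^ 4 * Λ * ‖transDeriv b'.chart (c 1) (w 1)‖ := by
  have hC := B.one_le_bound
  have hC0 := B.bound_pos
  have hK1 : 1 ≤ B.bound ^ 2 * L := one_le_mul_of_one_le_of_one_le (one_le_pow₀ hC) hL
  have hK0 : 0 < B.bound ^ 2 * L := one_pos.trans_le hK1
  obtain ⟨b₁, hb₁, F, H, h⟩ := B.exists_isSlide_of_bound hc hb hcb (div_pos B.size_pos hK0) hK1
    (mul_div_cancel₀ _ hK0.ne').le fun b' hb' t F H h v hv =>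
      ContinuousLinearMap.opNorm_le_bound _ hK0.le fun ξ => by
        have h1 := B.conformal hS hb hb' h hv h.center_mem ξ (transDeriv b.chart (c 0) (w 0))
        rw [← h.transDeriv_central hc hw] at h1
        refine le_of_mul_le_mul_right (h1.trans ?_) hw0
        calc _ ≤ B.bound ^ 2 * (L * ‖transDeriv b.chart (c 0) (w 0)‖) * ‖ξ‖ := by
              gcongr
              exact hwL t b' hb' h.mem'
          _ = _ := by ring
  have h1 := (B.norm_fderiv_of_isBounded hS hb hb₁ h hv hΛ (by rwa [h.source v hv]) h.center_mem
    (transDeriv b.chart (c 0) (w 0))).2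
  rw [← h.transDeriv_central hc hw] at h1
  calc _ ≤ _ := h1
    _ ≤ B.bound ^ 2 * Λ * (B.bound ^ 2 * ‖transDeriv b'.chart (c 1) (w 1)‖) := by
      gcongr
      exact B.norm_transDeriv_le hb' hb₁ hcb' (b₁.inner_subset_outer h.mem') _
    _ = _ := by ring

/-- The size of a parallel field is bounded. -/
theorem exists_norm_transDeriv_le (hc : ℱ.IsLeafPath c) {w : I → Euc (p + q)}
    (hw : ℱ.IsParallel c w) :
    ∃ R, ∀ t, ∀ b ∈ B.boxes, c t ∈ b.outer → ‖transDeriv b.chart (c t) (w t)‖ ≤ R := by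
  have := isCompact_univ.induction_on (X := I) (p := fun s => ∃ R, ∀ t ∈ s, ∀ b ∈ B.boxes,
    c t ∈ b.outer → ‖transDeriv b.chart (c t) (w t)‖ ≤ R) ⟨0, by simp⟩
    (fun s s' hss ⟨R, hR⟩ => ⟨R, fun t ht => hR t (hss ht)⟩)
    (fun s s' ⟨R, hR⟩ ⟨R', hR'⟩ => ⟨max R R', fun t ht b hb hcb => ht.elim
      (fun ht => (hR t ht b hb hcb).trans (le_max_left _ _))
      (fun ht => (hR' t ht b hb hcb).trans (le_max_right _ _))⟩)
    (fun t _ => by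
      obtain ⟨b, hb, hcb⟩ := B.covers (c t)
      refine ⟨_, nhdsWithin_le_nhds ((hw _ b.chart_mem t hcb.1).and
        (hc.1.continuousAt.eventually (b.isOpen_inner.mem_nhds hcb))),
        B.bound ^ 2 * ‖transDeriv b.chart (c t) (w t)‖, ?_⟩
      rintro s ⟨hs, hsb⟩ b' hb' hsb'
      rw [← hs]
      exact B.norm_transDeriv_le hb hb' (b.inner_subset_outer hsb) hsb' _)
  obtain ⟨R, hR⟩ := this
  exact ⟨R, fun t => hR t (mem_univ t)⟩

/-- If the distortion is unbounded at a point `x` of the closure, there is a leaf path from a point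
`m` of the leaf of `x` along which a parallel field never grows too much, but whose end is very
small: on a path along which the field is strongly distorted, run from a time where it is almost
maximal to the end where it is small. Hence all the points of a transversal ball of uniform size
around `m` have a large distortion. -/
theorem exists_large_distortion (hS : S.IsHolonomyInvariant) (hx : x ∈ closure B.boundedSet)
    (hx' : x ∉ B.boundedSet) {n : ℝ} (hn : 1 ≤ n) :
    ∃ m ∈ closure B.boundedSet, ∀ b ∈ B.boxes, m ∈ b.inner →
      ∀ v ∈ Metric.ball (b.chart m).2 (B.size / (B.bound ^ 2 * (2 * B.bound ^ 4))), ∀ Λ, 0 ≤ Λ →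
        B.IsBounded Λ (b.chart.symm ((b.chart m).1, v)) → n ≤ 2 * B.bound ^ 10 * Λ := by
  have hC := B.one_le_bound
  have hC0 := B.bound_pos
  have hnb : ¬ B.IsBounded n x := fun h => hx' ⟨n, hn, h⟩
  simp only [IsBounded, not_forall] at hnb
  obtain ⟨c, hc, rfl, w, hw, b, hb, b', hb', hcb, hcb', hd⟩ := hnb
  choose β hβ hcβ using fun t => B.covers (c t)
  have hcβ' := fun t => (β t).inner_subset_outer (hcβ t)
  set N : I → ℝ := fun t => ‖transDeriv (β t).chart (c t) (w t)‖ with hN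
  have hNb : ∀ t, ∀ b ∈ B.boxes, c t ∈ b.outer →
      ‖transDeriv b.chart (c t) (w t)‖ ≤ B.bound ^ 2 * N t ∧
      N t ≤ B.bound ^ 2 * ‖transDeriv b.chart (c t) (w t)‖ := fun t b hb hcb =>
    ⟨B.norm_transDeriv_le (hβ t) hb (hcβ' t) hcb _, B.norm_transDeriv_le hb (hβ t) hcb (hcβ' t) _⟩
  have hN0 : ∀ t, 0 ≤ N t := fun t => norm_nonneg _
  -- the field is small at one end `e` of the path, compared with the other end `e'`
  obtain ⟨e, e', he⟩ : ∃ e e' : I, n * N e < B.bound ^ 4 * N e' := by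
    obtain ⟨i1, i2⟩ := hNb 0 b hb hcb
    obtain ⟨j1, j2⟩ := hNb 1 b' hb' hcb'
    have hC2 : 0 < B.bound ^ 2 := by positivity
    rcases not_and_or.1 hd with hd | hd
    · refine ⟨0, 1, ?_⟩
      calc n * N 0 ≤ n * (B.bound ^ 2 * ‖transDeriv b.chart (c 0) (w 0)‖) := by gcongr
        _ = B.bound ^ 2 * (n * ‖transDeriv b.chart (c 0) (w 0)‖) := by ring
        _ < B.bound ^ 2 * ‖transDeriv b'.chart (c 1) (w 1)‖ := by gcongr; exact not_le.1 hd
        _ ≤ B.bound ^ 2 * (B.bound ^ 2 * N 1) := by gcongr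
        _ = _ := by ring
    · refine ⟨1, 0, ?_⟩
      calc n * N 1 ≤ n * (B.bound ^ 2 * ‖transDeriv b'.chart (c 1) (w 1)‖) := by gcongr
        _ = B.bound ^ 2 * (n * ‖transDeriv b'.chart (c 1) (w 1)‖) := by ring
        _ < B.bound ^ 2 * ‖transDeriv b.chart (c 0) (w 0)‖ := by gcongr; exact not_le.1 hd
        _ ≤ B.bound ^ 2 * (B.bound ^ 2 * N 0) := by gcongr
        _ = _ := by ring
  have hpos : 0 < N e' := by
    have h1 : 0 ≤ n * N e := mul_nonneg (zero_le_one.trans hn) (hN0 e)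
    exact pos_of_mul_pos_right (h1.trans_lt he) (by positivity)
  obtain ⟨R, hR⟩ := B.exists_norm_transDeriv_le hc hw
  have hbdd : BddAbove (range N) := ⟨R, by
    rintro _ ⟨t, rfl⟩
    exact hR t _ (hβ t) (hcβ' t)⟩
  have hle : ∀ t, N t ≤ sSup (range N) := fun t => le_csSup hbdd (mem_range_self t)
  obtain ⟨_, ⟨a, rfl⟩, ha⟩ := exists_lt_of_lt_csSup (range_nonempty N)
    (half_lt_self (hpos.trans_le (hle e')))
  have ha2 : ∀ t, N t ≤ 2 * N a := fun t => by linarith [hle t]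
  have ha0 : 0 < N a := by linarith [ha2 e']
  have hea : n * N e ≤ 2 * B.bound ^ 4 * N a := by
    refine he.le.trans ?_
    calc _ ≤ B.bound ^ 4 * (2 * N a) := by gcongr; exact ha2 e'
      _ = _ := by ring
  -- the point `m` is `c a`, and the path runs from `c a` to `c e`
  have hline : ∀ a e : I, ∃ θ : I → I, Continuous θ ∧ θ 0 = a ∧ θ 1 = e := fun a e =>
    ⟨fun s => ⟨AffineMap.lineMap (a : ℝ) (e : ℝ) (s : ℝ),
      (convex_Icc (0 : ℝ) 1).segment_subset a.2 e.2
        (segment_eq_image_lineMap ℝ (a : ℝ) (e : ℝ) ▸ mem_image_of_mem _ s.2)⟩,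
      (AffineMap.lineMap_continuous.comp continuous_subtype_val).subtype_mk _, by simp, by simp⟩
  obtain ⟨θ, hθ, hθ0, hθ1⟩ := hline a e
  refine ⟨c a, ?_, fun b hb hab v hv Λ hΛ hy => ?_⟩
  · obtain ⟨θ', hθ', hθ0', hθ1'⟩ := hline 0 a
    have := B.mem_closure_boundedSet_of_leafPath (hc.comp hθ') (by simpa [hθ0'] using hx)
    simpa [hθ1'] using this
  obtain ⟨i1, i2⟩ := hNb a b hb (b.inner_subset_outer hab)
  have hw0 : 0 < ‖transDeriv b.chart (c a) (w a)‖ :=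
    pos_of_mul_pos_right (ha0.trans_le i2) (by positivity)
  have key := B.norm_le_of_isBounded hS (hc.comp hθ) (hw.comp hθ) hb (b' := β e)
    (L := 2 * B.bound ^ 4) (v := v) (Λ := Λ) (by simpa [hθ0] using hab) (by simpa [hθ0] using hw0)
    (by nlinarith [one_le_pow₀ hC (n := 4)])
    (fun t b' hb' htb => ?_) (by simpa [hθ0] using hv) hΛ (by simpa [hθ0] using hy) (hβ e)
    (by simpa [hθ1] using hcβ' e)
  · simp only [Function.comp, hθ0, hθ1] at key
    refine le_of_mul_le_mul_right ?_ ha0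
    have hn0 : 0 ≤ n := zero_le_one.trans hn
    calc n * N a ≤ n * (B.bound ^ 2 * (B.bound ^ 4 * Λ * N e)) := by
          gcongr
          exact i2.trans (by gcongr)
      _ = B.bound ^ 6 * Λ * (n * N e) := by ring
      _ ≤ B.bound ^ 6 * Λ * (2 * B.bound ^ 4 * N a) := by gcongr
      _ = _ := by ring
  · simp only [Function.comp, hθ0]
    calc _ ≤ B.bound ^ 2 * N (θ t) := (hNb (θ t) b' hb' (b'.inner_subset_outer htb)).1
      _ ≤ B.bound ^ 2 * (2 * (B.bound ^ 2 * ‖transDeriv b.chart (c a) (w a)‖)) := by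
        gcongr
        exact (ha2 _).trans (by gcongr)
      _ = _ := by ring

/-- The points `m` given by `exists_large_distortion` for larger and larger distortions accumulate
at some point of the closure. A point of bounded distortion close to this accumulation point lies in
the transversal balls of infinitely many of them, which is absurd. -/
theorem isClosed_boundedSet [CompactSpace M] (hS : S.IsHolonomyInvariant) :
    IsClosed B.boundedSet := by
  refine isClosed_of_closure_subset fun x hx => ?_
  by_contra hx'
  choose m hm hmd using fun n : ℕ => B.exists_large_distortion hS hx hx' (n := n + 1) (by simp)
  obtain ⟨z, hz⟩ := exists_clusterPt_of_compactSpace (map m atTop)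
  have hfreq : ∀ U ∈ 𝓝 z, ∃ᶠ n in atTop, m n ∈ U := mapClusterPt_iff_frequently.1 hz
  have hzc : z ∈ closure B.boundedSet := by
    by_contra h
    obtain ⟨n, hn⟩ := (hfreq _ (isClosed_closure.isOpen_compl.mem_nhds h)).exists
    exact hn (hm n)
  have hC0 := B.bound_pos
  obtain ⟨b, hb, hzb⟩ := B.covers z
  set r := B.size / (B.bound ^ 2 * (2 * B.bound ^ 4))
  have hr0 : 0 < r := div_pos B.size_pos (by positivity)
  have hnear : ∀ᶠ y in 𝓝 z, y ∈ b.inner ∧ (b.chart y).2 ∈ Metric.ball (b.chart z).2 (r / 2) :=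
    Eventually.and (b.isOpen_inner.mem_nhds hzb)
      ((b.chart.continuousAt hzb.1).snd.eventually (Metric.ball_mem_nhds _ (half_pos hr0)))
  obtain ⟨y, ⟨hyb, hyz⟩, Λ, hΛ, hy⟩ := mem_closure_iff_nhds.1 hzc _ hnear
  obtain ⟨n₀, hn₀⟩ := exists_nat_gt (2 * B.bound ^ 10 * (B.bound ^ 2 * Λ))
  obtain ⟨n, ⟨hnb, hnz⟩, hn⟩ := ((hfreq _ hnear).and_eventually (eventually_ge_atTop n₀)).exists
  have hv : (b.chart y).2 ∈ Metric.ball (b.chart (m n)).2 r := by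
    rw [Metric.mem_ball] at *
    have := dist_triangle_right (b.chart y).2 (b.chart (m n)).2 (b.chart z).2
    linarith
  have hmem : ((b.chart (m n)).1, (b.chart y).2) ∈ Metric.ball b.center (2 * b.radius) :=
    b.mk_mem_ball hnb (b.ball_subset hyb le_rfl (Metric.mem_ball_self b.radius_pos))
  have hmem' := b.symm_mem_outer (Metric.ball_subset_closedBall hmem)
  have h1 := hmd n b hb hnb _ hv (B.bound ^ 2 * Λ) (by positivity)
    (hy.of_plaque (zero_le_one.trans hΛ) hb (b.inner_subset_outer hyb) hmem' (by
      rw [b.chart.right_inv (b.subset_target (Metric.ball_subset_closedBall hmem))]))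
  have h2 : (n₀ : ℝ) ≤ n := by exact_mod_cast hn
  linarith

end BoxCover

end Foliation

theorem mainTheorem8 {p q : ℕ} {M : Type*} [TopologicalSpace M] [T2Space M] [CompactSpace M]
    [ConnectedSpace M] [ChartedSpace (Euc (p + q)) M] [IsManifold (𝓡 (p + q)) ∞ M]
    (k : ContMDiffRiemannianMetric (𝓡 (p + q)) ∞ (Euc (p + q))
      (fun x : M => TangentSpace (𝓡 (p + q)) x))
    (ℱ : Foliation p q M) (S : ℱ.TransverseSimilarityStructure) (hS : S.IsHolonomyInvariant)
    (hE : (ℱ.biEquicontinuityDomain k).Nonempty) :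
    ℱ.biEquicontinuityDomain k = univ := by
  obtain ⟨B⟩ := Foliation.nonempty_boxCover S k
  rw [B.biEquicontinuityDomain_eq] at hE ⊢
  exact IsClopen.eq_univ ⟨B.isClosed_boundedSet hS, B.isOpen_boundedSet hS⟩ hE
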